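/- For $q\in\mathscr S(\mathbb R)$ put $r=-\bar q$, and for $\varkappa\in\mathbb C$ with $i\varkappa^2\in\mathbb R$, $|i\varkappa^2|\ge 1$, let $$L(\varkappa)=\begin{bmatrix}\partial_x+i\varkappa^2&-\varkappa q\\-\varkappa r&\partial_x-i\varkappa^2\end{bmatrix}$$ on $L^2(\mathbb R;\mathbb C^2)$ with domain $H^1(\mathbb R;\mathbb C^2)$. Let $G_0(x,y;\varkappa)$ be the integral kernel of $L(\varkappa)^{-1}$ for $q=0$: with $\theta=\mathbb 1_{(0,\infty)}+\tfrac12\mathbb 1_{\{0\}}$ it is $e^{-|i\varkappa^2|\,|x-y|}\,\mathrm{diag}(\theta(x-y),-\theta(y-x))$ if $i\varkappa^2>0$ and $e^{-|i\varkappa^2|\,|x-y|}\,\mathrm{diag}(-\theta(y-x),\theta(x-y))$ if $i\varkappa^2<0$. The Green's function $G(x,y;\varkappa)$ of $q$ is the integral kernel of the bounded inverse $L(\varkappa)^{-1}$, normalized so that $G-G_0$ is continuous on $\mathbb R\times\mathbb R$. Set $$\gamma(x)=\mathrm{sgn}(i\varkappa^2)\,[G_{11}(x,x)-G_{22}(x,x)]-1,\quad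 g_{12}(x)=\mathrm{sgn}(i\varkappa^2)\,G_{12}(x,x),\quad g_{21}(x)=\mathrm{sgn}(i\varkappa^2)\,G_{21}(x,x).$$ Theorem. There is an absolute constant $\delta>0$ with the following property. Let $\varkappa\in\mathbb C$ with $i\varkappa^2\in\mathbb R\setminus(-1,1)$, let $J\subseteq\mathbb R$ be an open interval containing $0$, and let $q\in C(J;\mathscr S(\mathbb R))$ be a solution of $$i\partial_tq+\partial_x^2q+i\partial_x(|q|^2q)=0\quad\text{on }J\times\mathbb R,\qquad \int_{\mathbb R}|q(0,x)|^2\,dx\le\delta .$$ Then for every $t\in J$ the operator $L(\varkappa)$ of $q(t)$ has a unique Green's function, and at every point of $J\times\mathbb R$ the derivatives below exist, $2+\gamma\ne0$, and (with $'=\partial_x$) $$\partial_tq=iq''+(q^2r)',\qquad \partial_tr=-ir''+(qr^2)',$$ $$\partial_tg_{12}=-2(2i\varkappa^4+i\varkappa^2qr)g_{12}-(2\varkappa^3q+i\varkappa q'+\varkappa q^2r)(\gamma+1),$$ $$\partial_tg_{21}=2(2i\varkappa^4+i\varkappa^2qr)g_{21}+(2\varkappa^3r-i\varkappa r'+\varkappa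 qr^2)(\gamma+1),$$ $$\partial_t\gamma=2\varkappa^2\gamma'+2i\varkappa(q'g_{21}+r'g_{12})+qr\gamma'.$$ Moreover $\partial_t\rho+\partial_xj_{\mathrm{DNLS}}=0$, where $$\rho=-\varkappa\frac{qg_{21}+rg_{12}}{2+\gamma},\qquad j_{\mathrm{DNLS}}=i\varkappa\frac{q'g_{21}-r'g_{12}}{2+\gamma}-i\varkappa^2qr-2\varkappa^2\rho-qr\rho .$$ -/

import Mathlib

open MeasureTheory Complex

namespace DNLS

noncomputable section

/-- The Hilbert space `L²(ℝ; ℂ²)`. -/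
abbrev L2Pair : Type := Lp (EuclideanSpace ℂ (Fin 2)) 2 (volume : Measure ℝ)

/-- The companion potential `r = -q̄`. -/
def negConj (q : ℝ → ℂ) : ℝ → ℂ := fun x => -(starRingEnd ℂ) (q x)

/-- `u` agrees almost everywhere with a locally absolutely continuous function whose derivative is
`v`. For square integrable `u` and `v` this says that `u ∈ H¹(ℝ)` with `u' = v`. -/
def HasPrimitiveDeriv (u v : ℝ → ℂ) : Prop :=
  ∃ c : ℂ, ∀ᵐ x : ℝ, u x = c + ∫ y in (0 : ℝ)..x, v y

/-- `u` lies in the domain `H¹(ℝ; ℂ²)` of the Lax operator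
`L(κ) = [[∂ + iκ², -κ q], [-κ r, ∂ - iκ²]]`, and `L(κ) u = f`. -/
def LaxEq (κ : ℂ) (q : ℝ → ℂ) (u f : L2Pair) : Prop :=
  ∃ v : L2Pair,
    (∀ i : Fin 2, HasPrimitiveDeriv (fun x => u x i) (fun x => v x i)) ∧
    (∀ᵐ x : ℝ, f x 0 = v x 0 + I * κ ^ 2 * u x 0 - κ * q x * u x 1) ∧
    (∀ᵐ x : ℝ, f x 1 = -κ * negConj q x * u x 0 + v x 1 - I * κ ^ 2 * u x 1)

/-- `L(κ)` is invertible on `L²(ℝ; ℂ²)` with bounded inverse `R`. -/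
def IsResolvent (κ : ℂ) (q : ℝ → ℂ) (R : L2Pair →L[ℂ] L2Pair) : Prop :=
  ∀ u f : L2Pair, LaxEq κ q u f ↔ u = R f

/-- `G` is an integral kernel of the operator `R`. -/
def HasKernel (R : L2Pair →L[ℂ] L2Pair) (G : ℝ → ℝ → Matrix (Fin 2) (Fin 2) ℂ) : Prop :=
  ∀ f : L2Pair, ∀ᵐ x : ℝ, ∀ i : Fin 2,
    Integrable (fun y : ℝ => ∑ j, G x y i j * f y j) ∧
      R f x i = ∫ y : ℝ, ∑ j, G x y i j * f y j

/-- The indicator of the positive half-line, with the value `1/2` (the mean of the one-sided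
limits) at `0`. -/
def step (x : ℝ) : ℂ := if 0 < x then 1 else if x = 0 then 1 / 2 else 0

/-- The integral kernel `G₀(x, y; κ)` of the inverse of the unperturbed operator
`diag(∂ + iκ², ∂ - iκ²)`, for real `iκ² ≠ 0`. With the value `1/2` of `step` at `0`, the difference
of the two diagonal entries is continuous across `x = y`. -/
def freeGreen (κ : ℂ) (x y : ℝ) : Matrix (Fin 2) (Fin 2) ℂ :=
  if 0 < (I * κ ^ 2).re then
    Complex.exp (-(I * κ ^ 2) * (|x - y| : ℝ)) • !![step (x - y), 0; 0, -step (y - x)]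
  else
    Complex.exp (I * κ ^ 2 * (|x - y| : ℝ)) • !![-step (y - x), 0; 0, step (x - y)]

/-- `G` is the Green's function of `L(κ)`: the integral kernel of the bounded inverse of `L(κ)`,
normalized so that `G - G₀` is continuous on `ℝ × ℝ`. -/
def IsGreenKernel (κ : ℂ) (q : ℝ → ℂ) (G : ℝ → ℝ → Matrix (Fin 2) (Fin 2) ℂ) : Prop :=
  (∃ R : L2Pair →L[ℂ] L2Pair, IsResolvent κ q R ∧ HasKernel R G) ∧
    Continuous fun p : ℝ × ℝ => G p.1 p.2 - freeGreen κ p.1 p.2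

open Classical in
/-- The Green's function `G(x, y; κ)` of `L(κ)` (zero if there is none). -/
def greenKernel (κ : ℂ) (q : ℝ → ℂ) : ℝ → ℝ → Matrix (Fin 2) (Fin 2) ℂ :=
  if h : ∃ G, IsGreenKernel κ q G then h.choose else 0

/-- The sign of the real number `iκ²`. -/
def sgn (κ : ℂ) : ℂ := (Real.sign (I * κ ^ 2).re : ℝ)

/-- `γ(x; κ) = sgn(iκ²) [G₁₁(x, x; κ) - G₂₂(x, x; κ)] - 1`. -/
def gam (κ : ℂ) (q : ℝ → ℂ) (x : ℝ) : ℂ :=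
  sgn κ * (greenKernel κ q x x 0 0 - greenKernel κ q x x 1 1) - 1

/-- `g₁₂(x; κ) = sgn(iκ²) G₁₂(x, x; κ)`. -/
def g12 (κ : ℂ) (q : ℝ → ℂ) (x : ℝ) : ℂ := sgn κ * greenKernel κ q x x 0 1

/-- `g₂₁(x; κ) = sgn(iκ²) G₂₁(x, x; κ)`. -/
def g21 (κ : ℂ) (q : ℝ → ℂ) (x : ℝ) : ℂ := sgn κ * greenKernel κ q x x 1 0

/-- The density `ρ(κ) = -κ (q g₂₁ + r g₁₂) / (2 + γ)`. -/
def density (κ : ℂ) (q : ℝ → ℂ) (x : ℝ) : ℂ :=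
  -κ * ((q x * g21 κ q x + negConj q x * g12 κ q x) / (2 + gam κ q x))

/-- The flux
`j(κ) = iκ (q' g₂₁ - r' g₁₂) / (2 + γ) - iκ² q r - 2κ² ρ(κ) - q r ρ(κ)`. -/
def flux (κ : ℂ) (q : ℝ → ℂ) (x : ℝ) : ℂ :=
  I * κ * ((deriv q x * g21 κ q x - deriv (negConj q) x * g12 κ q x) / (2 + gam κ q x))
    - I * κ ^ 2 * q x * negConj q x
    - 2 * κ ^ 2 * density κ q x
    - q x * negConj q x * density κ q x

/-- `q` is a Schwartz solution on the time set `J` of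
`i ∂ₜq + ∂ₓ²q + i ∂ₓ(|q|² q) = 0`: a continuous curve in the Schwartz space that satisfies the
equation at every point of `J × ℝ`. -/
def IsSchwartzSolution (J : Set ℝ) (q : ℝ → SchwartzMap ℝ ℂ) : Prop :=
  ContinuousOn q J ∧
    ∀ t ∈ J, ∀ x : ℝ,
      DifferentiableAt ℝ (fun τ : ℝ => q τ x) t ∧
        I * deriv (fun τ : ℝ => q τ x) t + iteratedDeriv 2 (fun y : ℝ => q t y) x
          + I * deriv (fun y : ℝ => ((‖q t y‖ ^ 2 : ℝ) : ℂ) * q t y) x = 0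

end

end DNLS

open MeasureTheory Complex

namespace DNLS

open Set Filter Topology BoundedContinuousFunction
open scoped ENNReal ComplexConjugate

/-! Write `k = iκ²`. Suppose that `(a, b) e^{-kx}` and `(c, d) e^{kx}` solve `L ψ = 0` and that `M =
[[a, c], [b, d]]` is bounded with determinant one. Then `L = M L₀ M⁻¹`, so that `M(x) G₀(x, y)
M(y)⁻¹` is a Green's function (`IsFrame.isGreenKernel`). It is the only one, because two of them
differ by a continuous kernel of the zero operator. On the diagonal only the ratios `u = b / a` and
`v = c / d` survive: `γ + 1 = (1 + uv) / (1 - uv)`, `g₁₂ = -v / (1 - uv)`, `g₂₁ = u / (1 - uv)`.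

The ratios satisfy `u' = 2ku + κr - κq u²` and `v' = -2kv + κq - κr v²`. Since `|κ|² = |k|`, small
mass makes the coefficients small in `L²` relative to `|k|`, with a threshold independent of `κ`. A
contraction argument then gives solutions bounded by `1/2` (`exists_isRiccati`), and from these a
frame (`IsRiccati.exists_isFrame`). Conservation of mass carries the smallness from time `0` to all
of `J`.

For the time evolution, the other half of the Lax pair predicts `∂ₜu = C + 2A u - B u²`, and
similarly for `v`. The prediction is bounded and, by compatibility of the two halves, solves the
linearized spatial equation. Bounded solutions of such equations are controlled by their source,
which forces the difference quotients to converge to the prediction (`hasDerivAt_of_isRiccati`). The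
evolution equations follow by differentiating rational functions of `u` and `v`. The conservation
law is a direct computation, because `ρ = -κ/2 (q u - r v)`. -/

/-! ### Bounded solutions of scalar linear equations on the line -/

/-- A bounded solution of `E' = l E + h` with `l > 0` is controlled by the `L²` size and the
supremum of the two parts of `h`. -/
lemma norm_le_of_hasDerivAt_pos {l G S B : ℝ} (hl : 0 < l) {E h : ℝ → ℂ} {φ : ℝ → ℝ}
    (hφc : Continuous φ) (hφi : Integrable fun x => φ x ^ 2) (hφ : ∫ x, φ x ^ 2 ≤ l / 8)
    (hE : ∀ x, ‖E x‖ ≤ B) (hd : ∀ x, HasDerivAt E (l * E x + h x) x)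
    (hG : 0 ≤ G) (hh : ∀ x, ‖h x‖ ≤ φ x * G + S) (x : ℝ) :
    ‖E x‖ ≤ G / 4 + S / l := by
  set Φ : ℝ → ℂ := fun y => ((Real.exp (-l * (y - x)) : ℝ) : ℂ) * E y with hΦ
  -- An antiderivative of the majorant of `‖Φ'‖`. Young's inequality `e φ ≤ (l/4) e² + φ²/l`
  -- replaces Cauchy–Schwarz; its two terms integrate to at most `1/8` each, whence the factor
  -- `1/4`.
  set ψ : ℝ → ℝ := fun y => G * (-(1 / 8) * Real.exp (-2 * l * (y - x)) +
    (1 / l) * ∫ z in x..y, φ z ^ 2) - S / l * Real.exp (-l * (y - x)) with hψ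
  have hexp : ∀ (c y : ℝ), HasDerivAt (fun y => Real.exp (c * (y - x)))
      (c * Real.exp (c * (y - x))) y := by
    intro c y
    have := (((hasDerivAt_id y).sub_const x).const_mul c).exp
    convert! this using 1
    simp [mul_comm]
  have hΦd : ∀ y, HasDerivAt Φ (((Real.exp (-l * (y - x)) : ℝ) : ℂ) * h y) y := by
    intro y
    have := (hexp (-l) y).ofReal_comp.mul (hd y)
    convert! this using 1
    push_cast
    ring
  have hψd : ∀ y, HasDerivAt ψ (G * (l / 4 * Real.exp (-2 * l * (y - x)) + 1 / l * φ y ^ 2) +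
      S * Real.exp (-l * (y - x))) y := by
    intro y
    have h1 : HasDerivAt (fun y => ∫ z in x..y, φ z ^ 2) (φ y ^ 2) y :=
      intervalIntegral.integral_hasDerivAt_right ((hφc.pow 2).intervalIntegrable _ _)
        (hφc.pow 2).aestronglyMeasurable.stronglyMeasurableAtFilter (hφc.pow 2).continuousAt
    have := ((((hexp (-2 * l) y).const_mul (-(1 / 8))).add (h1.const_mul (1 / l))).const_mul G).sub
      ((hexp (-l) y).const_mul (S / l))
    convert! this using 1
    field_simp
    ring
  have hbound : ∀ y, ‖((Real.exp (-l * (y - x)) : ℝ) : ℂ) * h y‖ ≤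
      G * (l / 4 * Real.exp (-2 * l * (y - x)) + 1 / l * φ y ^ 2) +
      S * Real.exp (-l * (y - x)) := by
    intro y
    rw [norm_mul, Complex.norm_real, Real.norm_of_nonneg (Real.exp_pos _).le]
    have h2 : Real.exp (-2 * l * (y - x)) = Real.exp (-l * (y - x)) ^ 2 := by
      rw [← Real.exp_nat_mul]; congr 1; push_cast; ring
    rw [h2]
    set e := Real.exp (-l * (y - x))
    have he : 0 < e := Real.exp_pos _
    have h3 : e * φ y ≤ l / 4 * e ^ 2 + 1 / l * φ y ^ 2 := by
      have : l / 4 * e ^ 2 + 1 / l * φ y ^ 2 - e * φ y = (l * e / 2 - φ y) ^ 2 / l := by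
        field_simp; ring
      have : 0 ≤ (l * e / 2 - φ y) ^ 2 / l := by positivity
      linarith
    calc e * ‖h y‖ ≤ e * (φ y * G + S) := by gcongr; exact hh y
      _ = G * (e * φ y) + S * e := by ring
      _ ≤ _ := by gcongr
  have hle : ∀ X, x ≤ X → ‖Φ X - Φ x‖ ≤ ψ X - ψ x := by
    intro X hX
    have hΦ' : ∀ y, HasDerivAt (fun y => Φ y - Φ x) (((Real.exp (-l * (y - x)) : ℝ) : ℂ) * h y) y :=
      fun y => (hΦd y).sub_const _
    have hψ' := fun y => (hψd y).sub_const (ψ x)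
    exact image_norm_le_of_norm_deriv_right_le_deriv_boundary
      (f := fun y => Φ y - Φ x) (B := fun y => ψ y - ψ x) (a := x) (b := X)
      (fun y _ => (hΦ' y).continuousAt.continuousWithinAt)
      (fun y _ => (hΦ' y).hasDerivWithinAt) (by simp) (fun y => hψ' y)
      (fun y _ => hbound y) ⟨hX, le_rfl⟩
  have hψle : ∀ X, x ≤ X → ψ X - ψ x ≤ G / 4 + S / l * (1 - Real.exp (-l * (X - x))) := by
    intro X hX
    have h1 : ∫ z in x..X, φ z ^ 2 ≤ l / 8 := by
      rw [intervalIntegral.integral_of_le hX]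
      exact (setIntegral_le_integral hφi (ae_of_all _ fun _ => sq_nonneg _)).trans hφ
    have h2 : 1 / l * ∫ z in x..X, φ z ^ 2 ≤ 1 / 8 := by
      calc 1 / l * ∫ z in x..X, φ z ^ 2 ≤ 1 / l * (l / 8) := by gcongr
        _ = 1 / 8 := by field_simp
    have h3 : 0 < Real.exp (-2 * l * (X - x)) := Real.exp_pos _
    have : ψ X - ψ x = G * (1 / 8 - 1 / 8 * Real.exp (-2 * l * (X - x))
        + 1 / l * ∫ z in x..X, φ z ^ 2) + S / l * (1 - Real.exp (-l * (X - x))) := by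
      simp only [hψ, sub_self, mul_zero, Real.exp_zero, intervalIntegral.integral_same]
      ring
    rw [this]
    have : G * (1 / 8 - 1 / 8 * Real.exp (-2 * l * (X - x))
        + 1 / l * ∫ z in x..X, φ z ^ 2) ≤ G * (1 / 4) := by
      gcongr; linarith
    linarith
  have hmain : ∀ X, x ≤ X → ‖E x‖ ≤ B * Real.exp (-l * (X - x)) + (G / 4 +
      S / l * (1 - Real.exp (-l * (X - x)))) := by
    intro X hX
    have h1 := (hle X hX).trans (hψle X hX)
    have h2 : Φ x = E x := by simp [hΦ]
    have h3 : ‖Φ X‖ ≤ B * Real.exp (-l * (X - x)) := by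
      simp only [hΦ]
      rw [norm_mul, Complex.norm_real, Real.norm_of_nonneg (Real.exp_pos _).le, mul_comm]
      gcongr
      exact hE X
    have h4 : ‖Φ x‖ ≤ ‖Φ X‖ + ‖Φ X - Φ x‖ := by
      have := norm_sub_le (Φ X) (Φ X - Φ x)
      simpa using this
    rw [← h2]; linarith
  -- Boundedness of `E` kills the boundary term at `+∞`, so no homogeneous solution `e^{lx}` can
  -- contribute.
  have hlim : Tendsto (fun X : ℝ => Real.exp (-l * (X - x))) atTop (𝓝 0) := by
    refine Real.tendsto_exp_atBot.comp ?_
    exact (tendsto_atTop_add_const_right _ (-x) tendsto_id).const_mul_atTop_of_neg (by linarith)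
  have hlim2 := ((hlim.const_mul B).add
    (((hlim.const_sub 1).const_mul (S / l)).const_add (G / 4)))
  have := ge_of_tendsto hlim2 ((eventually_ge_atTop x).mono hmain)
  simpa using this

/-- A bounded solution of `E' = l E + h` with `l ≠ 0` is controlled by the `L²` size and the
supremum of the two parts of `h`. -/
lemma norm_le_of_hasDerivAt {l G S B : ℝ} (hl : l ≠ 0) {E h : ℝ → ℂ} {φ : ℝ → ℝ}
    (hφc : Continuous φ) (hφi : Integrable fun x => φ x ^ 2) (hφ : ∫ x, φ x ^ 2 ≤ |l| / 8)
    (hE : ∀ x, ‖E x‖ ≤ B) (hd : ∀ x, HasDerivAt E (l * E x + h x) x)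
    (hG : 0 ≤ G) (hh : ∀ x, ‖h x‖ ≤ φ x * G + S) (x : ℝ) :
    ‖E x‖ ≤ G / 4 + S / |l| := by
  rcases lt_or_gt_of_ne hl with hneg | hpos
  · rw [abs_of_neg hneg] at hφ ⊢
    have := norm_le_of_hasDerivAt_pos (l := -l) (E := fun x => E (-x)) (h := fun x => -h (-x))
      (φ := fun x => φ (-x)) (by linarith) (hφc.comp continuous_neg) hφi.comp_neg
      (by rwa [integral_neg_eq_self (fun x => φ x ^ 2)]) (fun x => hE (-x))
      (fun x => by
        have h1 : HasDerivAt E (l * E (-x) + h (-x)) (-x) := hd (-x)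
        have := h1.scomp x (hasDerivAt_neg x)
        convert! this using 1
        simp) hG (fun x => by simpa using hh (-x)) (-x)
    simpa using this
  · rw [abs_of_pos hpos] at hφ ⊢
    exact norm_le_of_hasDerivAt_pos hpos hφc hφi hφ hE hd hG hh x

/-- A bounded solution of `E' = l E + w E + s` where `w` has small `L²` norm. -/
lemma norm_le_of_hasDerivAt_perturbed {l S B : ℝ} (hl : l ≠ 0) {E w s : ℝ → ℂ} {φ : ℝ → ℝ}
    (hφc : Continuous φ) (hφi : Integrable fun x => φ x ^ 2) (hφ : ∫ x, φ x ^ 2 ≤ |l| / 8)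
    (hE : ∀ x, ‖E x‖ ≤ B) (hd : ∀ x, HasDerivAt E (l * E x + (w x * E x + s x)) x)
    (hw : ∀ x, ‖w x‖ ≤ φ x) (hs : ∀ x, ‖s x‖ ≤ S) (x : ℝ) :
    ‖E x‖ ≤ 2 * (S / |l|) := by
  have hbdd : BddAbove (range fun x => ‖E x‖) := ⟨B, by rintro _ ⟨x, rfl⟩; exact hE x⟩
  set D := ⨆ x, ‖E x‖
  have hD : ∀ x, ‖E x‖ ≤ D := fun x => le_ciSup hbdd x
  have hD0 : 0 ≤ D := (norm_nonneg _).trans (hD 0)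
  have h1 : ∀ x, ‖E x‖ ≤ D / 4 + S / |l| :=
    norm_le_of_hasDerivAt hl hφc hφi hφ hE hd hD0 fun x => by
      calc ‖w x * E x + s x‖ ≤ ‖w x‖ * ‖E x‖ + ‖s x‖ := by
            rw [← norm_mul]; exact norm_add_le _ _
        _ ≤ φ x * D + S := by
            gcongr
            · exact (norm_nonneg _).trans (hw x)
            · exact hw x
            · exact hD x
            · exact hs x
  -- Absorption gives `D ≤ (4/3) S / |l|`. The bound `B` serves only to make `D` finite.
  have h2 : D ≤ D / 4 + S / |l| := ciSup_le h1
  have := hD x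
  have hS : 0 ≤ S / |l| := div_nonneg ((norm_nonneg _).trans (hs 0)) (abs_nonneg _)
  linarith

/-- The equation `E' = l E + F` with `l > 0` and bounded continuous `F` has a bounded solution. -/
lemma exists_bounded_solution {l : ℝ} (hl : 0 < l) (F : ℝ →ᵇ ℂ) :
    ∃ E : ℝ →ᵇ ℂ, ∀ x, HasDerivAt E (l * E x + F x) x := by
  set g : ℝ → ℂ := fun y => ((Real.exp (-l * y) : ℝ) : ℂ) * F y with hg
  have hgc : Continuous g := by fun_prop
  have hei : ∀ x, IntegrableOn (fun y => Real.exp (-l * y)) (Ioi x) :=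
    fun x => exp_neg_integrableOn_Ioi x hl
  have hgn : ∀ y, ‖g y‖ ≤ ‖F‖ * Real.exp (-l * y) := fun y => by
    simp only [hg]
    rw [norm_mul, Complex.norm_real, Real.norm_of_nonneg (Real.exp_pos _).le, mul_comm]
    gcongr
    exact F.norm_coe_le_norm y
  have hgi : ∀ x, IntegrableOn g (Ioi x) := fun x =>
    ((hei x).const_mul ‖F‖).mono' hgc.aestronglyMeasurable (ae_of_all _ hgn)
  have hsplit : ∀ x, ∫ y in Ioi x, g y = (∫ y in Ioi 0, g y) - ∫ y in (0 : ℝ)..x, g y := by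
    intro x
    rw [eq_sub_iff_add_eq, add_comm]
    exact intervalIntegral.integral_interval_add_Ioi (hgi 0) (hgi x)
  -- Variation of constants from `+∞`: since `e^{lx}` grows to the right, this is the choice of
  -- constant that keeps the solution bounded.
  set e : ℝ → ℂ := fun x => -(((Real.exp (l * x) : ℝ) : ℂ) * ∫ y in Ioi x, g y) with he
  have hed : ∀ x, HasDerivAt e (l * e x + F x) x := by
    intro x
    have h1 : HasDerivAt (fun x => ∫ y in Ioi x, g y) (-g x) x := by
      have : HasDerivAt (fun x => ∫ y in (0 : ℝ)..x, g y) (g x) x :=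
        intervalIntegral.integral_hasDerivAt_right (hgc.intervalIntegrable _ _)
          hgc.aestronglyMeasurable.stronglyMeasurableAtFilter hgc.continuousAt
      simpa only [← hsplit] using this.const_sub (∫ y in Ioi 0, g y)
    have h2 : HasDerivAt (fun x => ((Real.exp (l * x) : ℝ) : ℂ))
        (((l * Real.exp (l * x) : ℝ)) : ℂ) x := by
      have := (((hasDerivAt_id x).const_mul l).exp).ofReal_comp
      convert! this using 1
      simp [mul_comm]
    have := (h2.mul h1).neg
    convert! this using 1
    have h3 : ((Real.exp (l * x) : ℝ) : ℂ) * ((Real.exp (-l * x) : ℝ) : ℂ) = 1 := by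
      rw [← Complex.ofReal_mul, ← Real.exp_add]; simp
    simp only [he, hg]
    push_cast at h3 ⊢
    linear_combination (-F x) * h3
  have hen : ∀ x, ‖e x‖ ≤ ‖F‖ / l := by
    intro x
    simp only [he]
    rw [norm_neg, norm_mul, Complex.norm_real, Real.norm_of_nonneg (Real.exp_pos _).le]
    have h1 : ‖∫ y in Ioi x, g y‖ ≤ ‖F‖ * (Real.exp (-l * x) / l) := by
      refine (norm_integral_le_of_norm_le ((hei x).const_mul ‖F‖) (ae_of_all _ hgn)).trans ?_
      rw [integral_const_mul, integral_exp_mul_Ioi (by linarith)]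
      apply le_of_eq
      rw [neg_div_neg_eq]
    calc _ ≤ Real.exp (l * x) * (‖F‖ * (Real.exp (-l * x) / l)) := by gcongr
      _ = (Real.exp (l * x) * Real.exp (-l * x)) * (‖F‖ / l) := by ring
      _ = ‖F‖ / l := by rw [← Real.exp_add]; simp
  exact ⟨ofNormedAddCommGroup e (continuous_iff_continuousAt.2 fun x => (hed x).continuousAt) _ hen,
    hed⟩

/-! ### Riccati equations: existence and dependence on parameters -/

/-- `u` is a solution of the Riccati equation `u' = l u + p - s u²` that is bounded by `1/2`. -/
def IsRiccati (l : ℝ) (p s u : ℝ → ℂ) : Prop :=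
  (∀ x, ‖u x‖ ≤ 1 / 2) ∧ ∀ x, HasDerivAt u (l * u x + (p x - s x * u x ^ 2)) x

/-- A fixed point of the map sending `u` to the bounded solution of `E' = l E + p - s u²`. On the
ball of radius `1/2` the source is at most `(5/4) φ`, so the image has norm at most `5/16`. For two
elements of the ball the sources differ by at most `φ ‖u - w‖`, so the contraction ratio is `1/4`.
-/
lemma exists_isRiccati_pos {l : ℝ} (hl : 0 < l) (p s : ℝ →ᵇ ℂ) {φ : ℝ → ℝ}
    (hφc : Continuous φ) (hφi : Integrable fun x => φ x ^ 2) (hφ : ∫ x, φ x ^ 2 ≤ l / 8)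
    (hp : ∀ x, ‖p x‖ ≤ φ x) (hs : ∀ x, ‖s x‖ ≤ φ x) : ∃ u, IsRiccati l p s u := by
  choose S hS using fun F => exists_bounded_solution hl F
  set T : (ℝ →ᵇ ℂ) → (ℝ →ᵇ ℂ) := fun u => S (p - s * (u * u)) with hT
  have hTd : ∀ u x, HasDerivAt (T u) (l * T u x + (p x - s x * u x ^ 2)) x := fun u x => by
    simpa [hT, sq] using hS (p - s * (u * u)) x
  set K : Set (ℝ →ᵇ ℂ) := Metric.closedBall 0 (1 / 2)
  have hK : ∀ u ∈ K, ∀ x, ‖u x‖ ≤ 1 / 2 := fun u hu x =>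
    (u.norm_coe_le_norm x).trans (by simpa [K] using hu)
  have hmaps : MapsTo T K K := by
    intro u hu
    have : ∀ x, ‖T u x‖ ≤ (5 / 4) / 4 + 0 / l :=
      norm_le_of_hasDerivAt_pos hl hφc hφi hφ (fun x => (T u).norm_coe_le_norm x) (hTd u)
        (by norm_num) fun x => by
        have h1 := hK u hu x
        calc ‖p x - s x * u x ^ 2‖ ≤ ‖p x‖ + ‖s x‖ * ‖u x‖ ^ 2 := by
              rw [← norm_pow, ← norm_mul]; exact norm_sub_le _ _
          _ ≤ φ x + φ x * (1 / 2) ^ 2 := by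
              gcongr
              · exact hp x
              · exact (norm_nonneg _).trans (hp x)
              · exact hs x
          _ = _ := by ring
    simp only [K, mem_closedBall_zero_iff]
    rw [BoundedContinuousFunction.norm_le (by norm_num)]
    intro x
    exact (this x).trans (by norm_num)
  have hlip : LipschitzWith (1 / 4) (hmaps.restrict T K K) := by
    refine LipschitzWith.of_dist_le_mul ?_
    rintro ⟨u, hu⟩ ⟨w, hw⟩
    simp only [Subtype.dist_eq, MapsTo.val_restrict_apply]
    rw [dist_eq_norm, dist_eq_norm, BoundedContinuousFunction.norm_le (by positivity)]
    intro x
    have := norm_le_of_hasDerivAt_pos (G := ‖u - w‖) (S := 0) hl hφc hφi hφ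
      (fun x => (T u - T w).norm_coe_le_norm x)
      (E := fun x => (T u - T w) x) (h := fun x => -(s x * (u x + w x) * (u x - w x)))
      (fun x => by
        convert! (hTd u x).sub (hTd w x) using 1
        simp
        ring) (norm_nonneg _) (fun x => by
        have h2 : ‖u x + w x‖ ≤ 1 :=
          (norm_add_le _ _).trans (by linarith [hK u hu x, hK w hw x])
        have h3 : ‖u x - w x‖ ≤ ‖u - w‖ := (u - w).norm_coe_le_norm x
        have h4 := (norm_nonneg _).trans (hp x)
        rw [norm_neg, norm_mul, norm_mul, add_zero]
        calc ‖s x‖ * ‖u x + w x‖ * ‖u x - w x‖ ≤ φ x * 1 * ‖u - w‖ := by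
              gcongr; exact hs x
          _ = _ := by ring) x
    refine this.trans (le_of_eq ?_)
    push_cast
    ring
  obtain ⟨u, huK, hfix, -⟩ := ContractingWith.exists_fixedPoint'
    (Metric.isClosed_closedBall.isComplete : IsComplete K) hmaps
    ⟨by rw [← NNReal.coe_lt_coe]; norm_num, hlip⟩ (x := 0) (by simp) (edist_ne_top _ _)
  refine ⟨u, hK u huK, fun x => ?_⟩
  have := hTd u x
  rwa [hfix.eq] at this

lemma IsRiccati.comp_neg {l : ℝ} {p s u : ℝ → ℂ} (h : IsRiccati l p s u) :
    IsRiccati (-l) (fun x => -p (-x)) (fun x => -s (-x)) (fun x => u (-x)) := by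
  refine ⟨fun x => h.1 (-x), fun x => ?_⟩
  have := (h.2 (-x)).scomp x (hasDerivAt_neg x)
  convert! this using 1
  simp
  ring

/-- Riccati equations with coefficients small in `L²` have a solution bounded by `1/2`. -/
lemma exists_isRiccati {l : ℝ} (hl : l ≠ 0) (p s : ℝ →ᵇ ℂ) {φ : ℝ → ℝ}
    (hφc : Continuous φ) (hφi : Integrable fun x => φ x ^ 2) (hφ : ∫ x, φ x ^ 2 ≤ |l| / 8)
    (hp : ∀ x, ‖p x‖ ≤ φ x) (hs : ∀ x, ‖s x‖ ≤ φ x) : ∃ u, IsRiccati l p s u := by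
  rcases lt_or_gt_of_ne hl with hneg | hpos
  · rw [abs_of_neg hneg] at hφ
    obtain ⟨u, hu⟩ := exists_isRiccati_pos (l := -l) (by linarith)
      (-p.compContinuous ⟨fun x => -x, continuous_neg⟩)
      (-s.compContinuous ⟨fun x => -x, continuous_neg⟩)
      (φ := fun x => φ (-x)) (hφc.comp continuous_neg) hφi.comp_neg
      (by rwa [integral_neg_eq_self (fun x => φ x ^ 2)])
      (fun x => by simpa using hp (-x)) (fun x => by simpa using hs (-x))
    exact ⟨_, by simpa using hu.comp_neg⟩
  · rw [abs_of_pos hpos] at hφ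
    exact exists_isRiccati_pos hpos p s hφc hφi hφ hp hs

/-- Differentiability in a parameter of bounded solutions of Riccati equations: a bounded solution
of the linearized equation is the derivative. -/
lemma hasDerivAt_of_isRiccati {l : ℝ} (hl : l ≠ 0) {P S : ℝ → ℝ →ᵇ ℂ} {P' S' : ℝ →ᵇ ℂ} {t : ℝ}
    (hP : HasDerivAt P P' t) (hS : HasDerivAt S S' t) {φ : ℝ → ℝ}
    (hφc : Continuous φ) (hφi : Integrable fun x => φ x ^ 2) (hφ : ∫ x, φ x ^ 2 ≤ |l| / 8)
    (hs : ∀ x, ‖S t x‖ ≤ φ x) {u : ℝ → ℝ → ℂ} (hu : ∀ᶠ τ in 𝓝 t, IsRiccati l (P τ) (S τ) (u τ))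
    {U : ℝ → ℂ} {B : ℝ} (hUb : ∀ x, ‖U x‖ ≤ B)
    (hU : ∀ x, HasDerivAt U
      (l * U x + (P' x - S' x * u t x ^ 2 - 2 * S t x * u t x * U x)) x) (x : ℝ) :
    HasDerivAt (fun τ => u τ x) (U x) t := by
  have hut : IsRiccati l (P t) (S t) (u t) := hu.self_of_nhds
  have hl' : 0 < |l| := abs_pos.2 hl
  have hB : 0 ≤ B := (norm_nonneg _).trans (hUb 0)
  -- Factoring the difference of squares turns the nonlinearity into a potential multiplying `u τ -
  -- u t`. It is dominated by `φ` because both solutions are at most `1/2`.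
  have hw : ∀ τ, IsRiccati l (P τ) (S τ) (u τ) → ∀ x, ‖-(S t x * (u τ x + u t x))‖ ≤ φ x := by
    intro τ hτ x
    have h2 : ‖u τ x + u t x‖ ≤ 1 :=
      (norm_add_le _ _).trans (by linarith [hτ.1 x, hut.1 x])
    rw [norm_neg, norm_mul]
    calc ‖S t x‖ * ‖u τ x + u t x‖ ≤ φ x * 1 := by
          gcongr
          · exact (norm_nonneg _).trans (hs x)
          · exact hs x
      _ = _ := mul_one _
  -- Lipschitz dependence on the coefficients
  have hlip : ∀ τ, IsRiccati l (P τ) (S τ) (u τ) → ∀ x,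
      ‖u τ x - u t x‖ ≤ 2 * ((‖P τ - P t‖ + ‖S τ - S t‖) / |l|) := by
    intro τ hτ
    refine norm_le_of_hasDerivAt_perturbed (B := 1) hl hφc hφi hφ
      (E := fun x => u τ x - u t x) (w := fun x => -(S t x * (u τ x + u t x)))
      (s := fun x => (P τ - P t) x - (S τ - S t) x * u τ x ^ 2) (fun x => ?_) (fun x => ?_)
      (hw τ hτ) (fun x => ?_)
    · exact (norm_sub_le _ _).trans (by linarith [hτ.1 x, hut.1 x])
    · convert! (hτ.2 x).sub (hut.2 x) using 1
      simp
      ring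
    · have h1 := (P τ - P t).norm_coe_le_norm x
      have h2 := (S τ - S t).norm_coe_le_norm x
      have h3 : ‖u τ x‖ ^ 2 ≤ 1 := pow_le_one₀ (norm_nonneg _) (by linarith [hτ.1 x])
      calc _ ≤ ‖(P τ - P t) x‖ + ‖(S τ - S t) x‖ * ‖u τ x‖ ^ 2 := by
            rw [← norm_pow, ← norm_mul]; exact norm_sub_le _ _
        _ ≤ ‖P τ - P t‖ + ‖S τ - S t‖ * 1 := by gcongr
        _ = _ := by ring
  -- the remainder of the first order expansion
  set R : ℝ → ℝ := fun τ => ‖P τ - P t - (τ - t) • P'‖ + ‖S τ - S t - (τ - t) • S'‖ +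
    |τ - t| * (‖S'‖ + ‖S t‖ * B) * (2 * ((‖P τ - P t‖ + ‖S τ - S t‖) / |l|)) with hR
  have hrem : ∀ τ, IsRiccati l (P τ) (S τ) (u τ) → ∀ x,
      ‖u τ x - u t x - (τ - t) * U x‖ ≤ 2 * (R τ / |l|) := by
    intro τ hτ
    -- The source consists of the first order remainders of `P` and `S`, and of `τ - t` times a
    -- bounded multiple of `u τ - u t`. The Lipschitz bound makes the latter `o(τ - t)`.
    refine norm_le_of_hasDerivAt_perturbed (B := 1 + |τ - t| * B) hl hφc hφi hφ
      (E := fun x => u τ x - u t x - (τ - t) * U x) (w := fun x => -(S t x * (u τ x + u t x)))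
      (s := fun x => (P τ - P t - (τ - t) • P') x - (S τ - S t - (τ - t) • S') x * u τ x ^ 2
        - (τ - t) * (S' x * (u τ x + u t x) + S t x * U x) * (u τ x - u t x))
      (fun x => ?_) (fun x => ?_) (hw τ hτ) (fun x => ?_)
    · refine (norm_sub_le _ _).trans (add_le_add ?_ ?_)
      · exact (norm_sub_le _ _).trans (by linarith [hτ.1 x, hut.1 x])
      · rw [norm_mul, ← Complex.ofReal_sub, Complex.norm_real, Real.norm_eq_abs]
        gcongr
        exact hUb x
    · convert! ((hτ.2 x).sub (hut.2 x)).sub ((hU x).const_mul ((τ : ℂ) - t)) using 1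
      simp
      ring
    · have h1 := (P τ - P t - (τ - t) • P').norm_coe_le_norm x
      have h2 := (S τ - S t - (τ - t) • S').norm_coe_le_norm x
      have h3 : ‖u τ x‖ ^ 2 ≤ 1 := pow_le_one₀ (norm_nonneg _) (by linarith [hτ.1 x])
      have h4 : ‖u τ x + u t x‖ ≤ 1 :=
        (norm_add_le _ _).trans (by linarith [hτ.1 x, hut.1 x])
      have h5 : ‖S' x * (u τ x + u t x) + S t x * U x‖ ≤ ‖S'‖ + ‖S t‖ * B := by
        refine (norm_add_le _ _).trans ?_
        rw [norm_mul, norm_mul]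
        have := S'.norm_coe_le_norm x
        have := (S t).norm_coe_le_norm x
        calc _ ≤ ‖S'‖ * 1 + ‖S t‖ * B := by gcongr; exact hUb x
          _ = _ := by ring
      have h6 := hlip τ hτ x
      calc _ ≤ ‖(P τ - P t - (τ - t) • P') x‖ + ‖(S τ - S t - (τ - t) • S') x‖ * ‖u τ x‖ ^ 2
            + |τ - t| * ‖S' x * (u τ x + u t x) + S t x * U x‖ * ‖u τ x - u t x‖ := by
            rw [← norm_pow, ← norm_mul, ← Real.norm_eq_abs, ← Complex.norm_real, ← norm_mul,
              ← norm_mul, Complex.ofReal_sub]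
            exact (norm_sub_le _ _).trans (add_le_add_left (norm_sub_le _ _) _)
        _ ≤ ‖P τ - P t - (τ - t) • P'‖ + ‖S τ - S t - (τ - t) • S'‖ * 1 +
          |τ - t| * (‖S'‖ + ‖S t‖ * B) * (2 * ((‖P τ - P t‖ + ‖S τ - S t‖) / |l|)) := by
            gcongr
        _ = R τ := by simp only [hR]; ring
  rw [hasDerivAt_iff_isLittleO]
  have hPc : Tendsto (fun τ => ‖P τ - P t‖) (𝓝 t) (𝓝 0) := by
    simpa using (hP.continuousAt.tendsto.sub_const (P t)).norm
  have hSc : Tendsto (fun τ => ‖S τ - S t‖) (𝓝 t) (𝓝 0) := by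
    simpa using (hS.continuousAt.tendsto.sub_const (S t)).norm
  have hRo : R =o[𝓝 t] fun τ => τ - t := by
    refine ((hasDerivAt_iff_isLittleO.1 hP).norm_left.add
      (hasDerivAt_iff_isLittleO.1 hS).norm_left).add ?_
    have h1 : Tendsto (fun τ => (‖S'‖ + ‖S t‖ * B) *
        (2 * ((‖P τ - P t‖ + ‖S τ - S t‖) / |l|))) (𝓝 t) (𝓝 0) := by
      have := (((hPc.add hSc).div_const |l|).const_mul 2).const_mul (‖S'‖ + ‖S t‖ * B)
      simpa using this
    have h2 : (fun τ => |τ - t|) =O[𝓝 t] fun τ => τ - t :=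
      Asymptotics.isBigO_of_le _ fun τ => by simp
    have h3 := h2.mul_isLittleO ((Asymptotics.isLittleO_one_iff ℝ).2 h1)
    simpa [mul_assoc] using h3
  have hO : (fun τ => u τ x - u t x - (τ - t) • U x) =O[𝓝 t] R := by
    refine Asymptotics.IsBigO.of_bound (2 / |l|) ?_
    filter_upwards [hu] with τ hτ
    have h1 := hrem τ hτ x
    have h2 : (τ - t) • U x = ((τ : ℂ) - t) * U x := by simp
    rw [h2]
    calc _ ≤ 2 * (R τ / |l|) := h1
      _ = 2 / |l| * R τ := by ring
      _ ≤ _ := by gcongr; exact Real.le_norm_self _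
  exact hO.trans_isLittleO hRo

/-! ### Calculus of locally absolutely continuous functions -/

lemma intervalIntegrable_of_locallyIntegrable {f : ℝ → ℂ} (hf : LocallyIntegrable f) (a b : ℝ) :
    IntervalIntegrable f volume a b :=
  intervalIntegrable_iff.2 ((hf.integrableOn_isCompact isCompact_uIcc).mono_set uIoc_subset_uIcc)

lemma locallyIntegrable_continuous_mul {g f : ℝ → ℂ} (hg : Continuous g)
    (hf : LocallyIntegrable f) : LocallyIntegrable fun x => g x * f x :=
  locallyIntegrableOn_univ.1 ((hf.locallyIntegrableOn univ).continuousOn_mul hg.continuousOn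
    isOpen_univ.isLocallyClosed)

/-- Real and imaginary parts are treated separately, on an interval enlarged to contain the base
point `0`. -/
lemma absolutelyContinuousOnInterval_integral {f : ℝ → ℂ} (hf : LocallyIntegrable f) (a b : ℝ) :
    AbsolutelyContinuousOnInterval (fun x => ∫ y in (0 : ℝ)..x, f y) a b := by
  have hfi : ∀ x y, IntervalIntegrable f volume x y := 
    intervalIntegrable_of_locallyIntegrable hf
  have hre : AbsolutelyContinuousOnInterval (fun x => ∫ y in (0 : ℝ)..x, (f y).re) a b := by
    have : ∀ x y, IntervalIntegrable (fun y => (f y).re) volume x y :=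
      fun x y => ⟨(hfi x y).1.re, (hfi x y).2.re⟩
    have hle : a ⊓ (b ⊓ 0) ≤ a ⊔ (b ⊔ 0) := inf_le_left.trans le_sup_left
    refine ((this (a ⊓ (b ⊓ 0)) (a ⊔ (b ⊔ 0))).absolutelyContinuousOnInterval_intervalIntegral
      (c := 0) ?_).mono ?_
    · rw [uIcc_of_le hle]; simp
    · rw [uIcc_of_le hle]
      exact uIcc_subset_Icc (by simp) (by simp)
  have him : AbsolutelyContinuousOnInterval (fun x => ∫ y in (0 : ℝ)..x, (f y).im) a b := by
    have : ∀ x y, IntervalIntegrable (fun y => (f y).im) volume x y :=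
      fun x y => ⟨(hfi x y).1.im, (hfi x y).2.im⟩
    have hle : a ⊓ (b ⊓ 0) ≤ a ⊔ (b ⊔ 0) := inf_le_left.trans le_sup_left
    refine ((this (a ⊓ (b ⊓ 0)) (a ⊔ (b ⊔ 0))).absolutelyContinuousOnInterval_intervalIntegral
      (c := 0) ?_).mono ?_
    · rw [uIcc_of_le hle]; simp
    · rw [uIcc_of_le hle]
      exact uIcc_subset_Icc (by simp) (by simp)
  have hconst : ∀ z : ℂ, AbsolutelyContinuousOnInterval (fun _ : ℝ => z) a b := fun z =>
    (LipschitzWith.const z).lipschitzOnWith.absolutelyContinuousOnInterval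
  convert! (hre.smul (hconst 1)).add (him.smul (hconst I)) using 1
  funext x
  have h1 := Complex.reCLM.intervalIntegral_comp_comm (hfi 0 x)
  have h2 := Complex.imCLM.intervalIntegral_comp_comm (hfi 0 x)
  simp only [reCLM_apply, imCLM_apply] at h1 h2
  apply Complex.ext <;> simp [h1, h2]

/-- The product rule for a `C¹` factor: the difference of the two sides is absolutely continuous
with derivative zero almost everywhere, hence constant, and its value is read off at `0`. -/
lemma mul_primitive_eq {g g' v : ℝ → ℂ} (hg : ∀ x, HasDerivAt g (g' x) x) (hg' : Continuous g')
    (hv : LocallyIntegrable v) (c : ℂ) (x : ℝ) :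
    g x * (c + ∫ y in (0 : ℝ)..x, v y) =
      g 0 * c + ∫ y in (0 : ℝ)..x, (g' y * (c + ∫ z in (0 : ℝ)..y, v z) + g y * v y) := by
  have hgc : Continuous g := continuous_iff_continuousAt.2 fun x => (hg x).continuousAt
  have hF : Continuous fun y => ∫ z in (0 : ℝ)..y, v z :=
    intervalIntegral.continuous_primitive (intervalIntegrable_of_locallyIntegrable hv) 0
  have hw : LocallyIntegrable fun y => g' y * (c + ∫ z in (0 : ℝ)..y, v z) + g y * v y := by
    exact (Continuous.locallyIntegrable (by fun_prop)).add
      (locallyIntegrable_continuous_mul hgc hv)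
  have hconst : ∀ z : ℂ, AbsolutelyContinuousOnInterval (fun _ : ℝ => z) 0 x := fun z =>
    (LipschitzWith.const z).lipschitzOnWith.absolutelyContinuousOnInterval
  have hgac : AbsolutelyContinuousOnInterval g 0 x := by
    have h := absolutelyContinuousOnInterval_integral hg'.locallyIntegrable 0 x
    convert! (hconst (g 0)).add h using 1
    funext y
    have := intervalIntegral.integral_eq_sub_of_hasDerivAt (fun z _ => hg z)
      (hg'.intervalIntegrable 0 y)
    simp [this]
  have hac := (hgac.smul ((hconst c).add (absolutelyContinuousOnInterval_integral hv 0 x))).sub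
    (absolutelyContinuousOnInterval_integral hw 0 x)
  obtain ⟨C, hC⟩ := hac.const_of_ae_hasDerivAt_zero (by
    filter_upwards [_root_.LocallyIntegrable.ae_hasDerivAt_integral hv,
      _root_.LocallyIntegrable.ae_hasDerivAt_integral hw] with y h1 h2 _
    convert! ((hg y).mul ((h1 0).const_add c)).sub (h2 0) using 1
    simp only [sub_self])
  have h0 := hC 0 (by simp)
  have hx := hC x (by simp)
  have h : g x * (c + ∫ y in (0 : ℝ)..x, v y) -
      ∫ y in (0 : ℝ)..x, (g' y * (c + ∫ z in (0 : ℝ)..y, v z) + g y * v y) = g 0 * c := by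
    have h1 := hx.trans h0.symm
    simpa using h1
  rw [← h]
  ring

namespace HasPrimitiveDeriv

lemma congr {u u' v v' : ℝ → ℂ} (h : HasPrimitiveDeriv u v) (hu : u =ᵐ[volume] u')
    (hv : v =ᵐ[volume] v') : HasPrimitiveDeriv u' v' := by
  obtain ⟨c, hc⟩ := h
  refine ⟨c, ?_⟩
  filter_upwards [hc, hu] with x h1 h2
  rw [← h2, h1, intervalIntegral.integral_congr_ae (hv.mono fun y hy _ => hy)]

lemma add {u₁ u₂ v₁ v₂ : ℝ → ℂ} (h₁ : HasPrimitiveDeriv u₁ v₁) (h₂ : HasPrimitiveDeriv u₂ v₂)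
    (hv₁ : LocallyIntegrable v₁) (hv₂ : LocallyIntegrable v₂) :
    HasPrimitiveDeriv (fun x => u₁ x + u₂ x) (fun x => v₁ x + v₂ x) := by
  obtain ⟨c₁, hc₁⟩ := h₁
  obtain ⟨c₂, hc₂⟩ := h₂
  refine ⟨c₁ + c₂, ?_⟩
  filter_upwards [hc₁, hc₂] with x h1 h2
  rw [h1, h2, intervalIntegral.integral_add (intervalIntegrable_of_locallyIntegrable hv₁ _ _)
    (intervalIntegrable_of_locallyIntegrable hv₂ _ _)]
  ring

lemma mul_left {g g' u v : ℝ → ℂ} (h : HasPrimitiveDeriv u v) (hg : ∀ x, HasDerivAt g (g' x) x)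
    (hg' : Continuous g') (hv : LocallyIntegrable v) :
    HasPrimitiveDeriv (fun x => g x * u x) (fun x => g' x * u x + g x * v x) := by
  obtain ⟨c, hc⟩ := h
  refine ⟨g 0 * c, ?_⟩
  filter_upwards [hc] with x hx
  rw [hx, mul_primitive_eq hg hg' hv c x]
  congr 1
  refine intervalIntegral.integral_congr_ae ?_
  filter_upwards [hc] with y hy _
  rw [hy]

lemma comp_neg {u v : ℝ → ℂ} (h : HasPrimitiveDeriv u v) :
    HasPrimitiveDeriv (fun x => u (-x)) (fun x => -v (-x)) := by
  obtain ⟨c, hc⟩ := h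
  refine ⟨c, ?_⟩
  have := (Measure.measurePreserving_neg (volume : Measure ℝ)).quasiMeasurePreserving.ae hc
  filter_upwards [this] with x hx
  rw [hx, intervalIntegral.integral_neg, intervalIntegral.integral_comp_neg (fun y => v y),
    intervalIntegral.integral_symm]
  simp

end HasPrimitiveDeriv

/-! ### Inversion of `∂ + l` on `L²(ℝ)` -/

/-- The integral kernel of the inverse of `∂ + l` on the line, for real `l ≠ 0`. -/
noncomputable def freeKernel (l z : ℝ) : ℂ :=
  if 0 < l then ((Real.exp (-l * z) : ℝ) : ℂ) * step z else
    -(((Real.exp (-l * z) : ℝ) : ℂ) * step (-z))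

lemma integrableOn_exp_mul {l : ℝ} (hl : 0 < l) {h : ℝ → ℂ} (hh : MemLp h 2) (x : ℝ) :
    IntegrableOn (fun y => ((Real.exp (l * y) : ℝ) : ℂ) * h y) (Iic x) := by
  have h1 : MemLp (fun y : ℝ => ((Real.exp (l * y) : ℝ) : ℂ)) 2 (volume.restrict (Iic x)) := by
    refine (memLp_two_iff_integrable_sq_norm
      (by fun_prop : Continuous _).aestronglyMeasurable).2 ?_
    have := integrableOn_exp_mul_Iic (a := 2 * l) (by linarith) x
    refine this.congr_fun (fun y _ => ?_) measurableSet_Iic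
    simp only [Complex.norm_real, Real.norm_of_nonneg (Real.exp_pos _).le]
    rw [← Real.exp_nat_mul]
    congr 1
    push_cast
    ring
  exact h1.integrable_mul (hh.restrict _)

lemma integral_freeKernel_of_pos {l : ℝ} (hl : 0 < l) (h : ℝ → ℂ) (x : ℝ) :
    ∫ y, freeKernel l (x - y) * h y =
      ((Real.exp (-l * x) : ℝ) : ℂ) * ∫ y in Iic x, ((Real.exp (l * y) : ℝ) : ℂ) * h y := by
  rw [← integral_const_mul, ← integral_indicator measurableSet_Iic]
  refine integral_congr_ae ?_
  have : ∀ᵐ y : ℝ, y ≠ x := by simp [ae_iff]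
  filter_upwards [this] with y hy
  simp only [freeKernel, if_pos hl, step]
  rcases lt_or_gt_of_ne hy with h1 | h1
  · rw [indicator_of_mem (by simpa using h1.le), if_pos (by linarith), ← mul_assoc,
      ← Complex.ofReal_mul, ← Real.exp_add, mul_one]
    congr 3
    ring_nf
  · rw [indicator_of_notMem (by simpa using h1), if_neg (by linarith), if_neg (by linarith)]
    simp

/-- The integrating factor `e^{lx}` turns the equation into `(e^{lx} w)' = e^{lx} h`, whose right
side is integrable near `-∞`. Square integrability of `w` then fixes the constant of integration. -/
lemma hasPrimitiveDeriv_iff_of_pos {l : ℝ} (hl : 0 < l) {w h : ℝ → ℂ} (hw : MemLp w 2)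
    (hh : MemLp h 2) :
    HasPrimitiveDeriv w (fun x => h x - l * w x) ↔
      ∀ᵐ x, w x = ∫ y, freeKernel l (x - y) * h y := by
  have hhi : LocallyIntegrable h := hh.locallyIntegrable (by norm_num)
  set H : ℝ → ℂ := fun y => ((Real.exp (l * y) : ℝ) : ℂ) * h y with hH
  have hexp : ∀ a x : ℝ, HasDerivAt (fun x : ℝ => ((Real.exp (a * x) : ℝ) : ℂ))
      (a * ((Real.exp (a * x) : ℝ) : ℂ)) x := by
    intro a x
    have := (((hasDerivAt_id x).const_mul a).exp).ofReal_comp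
    convert! this using 1
    simp [mul_comm]
  have hexpc : ∀ a : ℝ, Continuous fun x : ℝ => (a : ℂ) * ((Real.exp (a * x) : ℝ) : ℂ) :=
    fun a => by fun_prop
  have hHi : LocallyIntegrable H := locallyIntegrable_continuous_mul (by fun_prop) hhi
  have hsplit : ∀ x, ∫ y in Iic x, H y = (∫ y in Iic 0, H y) + ∫ y in (0 : ℝ)..x, H y := by
    intro x
    have := intervalIntegral.integral_Iic_sub_Iic (integrableOn_exp_mul hl hh 0)
      (integrableOn_exp_mul hl hh x)
    rw [← this]
    ring
  simp only [integral_freeKernel_of_pos hl]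
  constructor
  · intro hp
    have h1 := hp.mul_left (hexp l) (hexpc l) ((hh.sub (hw.const_mul (l : ℂ))).locallyIntegrable (by norm_num))
    have h2 := h1.congr (v' := H) EventuallyEq.rfl (ae_of_all _ fun x => by
      simp only [hH]; ring)
    obtain ⟨c, hc⟩ := h2
    set L := c - ∫ y in Iic 0, H y with hL
    have hc' : ∀ᵐ x, w x = ((Real.exp (-l * x) : ℝ) : ℂ) * (L + ∫ y in Iic x, H y) := by
      filter_upwards [hc] with x hx
      have h3 : ((Real.exp (-l * x) : ℝ) : ℂ) * ((Real.exp (l * x) : ℝ) : ℂ) = 1 := by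
        rw [← Complex.ofReal_mul, ← Real.exp_add]; simp
      rw [hsplit x, hL]
      linear_combination ((Real.exp (-l * x) : ℝ) : ℂ) * hx - w x * h3
    -- If `L ≠ 0`, then `‖w‖ ≥ ‖L‖ / 2` almost everywhere on a left half-line, a set of infinite
    -- measure, against Chebyshev's inequality for `w ∈ L²`.
    have hL0 : L = 0 := by
      by_contra hne
      have hpos : 0 < ‖L‖ / 2 := by positivity
      have hlim : Tendsto (fun x => ∫ y in Iic x, H y) atBot (𝓝 0) := by
        have := intervalIntegral_tendsto_integral_Iic (f := H) 0 (integrableOn_exp_mul hl hh 0)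
          tendsto_id
        have h4 := this.const_sub (∫ y in Iic 0, H y)
        rw [sub_self] at h4
        refine h4.congr fun x => ?_
        rw [hsplit x, intervalIntegral.integral_symm]
        simp
      have hev : ∀ᶠ x in atBot, ‖∫ y in Iic x, H y‖ < ‖L‖ / 2 := by
        have := hlim.norm
        rw [norm_zero] at this
        exact this.eventually_lt_const hpos
      obtain ⟨X, hX⟩ := eventually_atBot.1 (hev.and (eventually_le_atBot 0))
      have hfin := hw.meas_ge_lt_top (by norm_num) (by norm_num) (ε := (‖L‖ / 2).toNNReal)
        (by simpa using hne)
      have hle : volume (Iic X) ≤ volume {x | (‖L‖ / 2).toNNReal ≤ ‖w x‖₊} := by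
        refine measure_mono_ae ?_
        filter_upwards [hc'] with x hx hxX
        have hx2 := hX x hxX
        change (‖L‖ / 2).toNNReal ≤ ‖w x‖₊
        rw [← NNReal.coe_le_coe, coe_nnnorm, Real.coe_toNNReal _ hpos.le, hx, norm_mul,
          Complex.norm_real, Real.norm_of_nonneg (Real.exp_pos _).le]
        have h5 : 1 ≤ Real.exp (-l * x) := Real.one_le_exp (by nlinarith [hx2.2])
        have h6 : ‖L‖ / 2 ≤ ‖L + ∫ y in Iic x, H y‖ := by
          have := norm_sub_le (L + ∫ y in Iic x, H y) (∫ y in Iic x, H y)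
          rw [add_sub_cancel_right] at this
          linarith [hx2.1]
        nlinarith
      simp only [Real.volume_Iic, top_le_iff] at hle
      exact hfin.ne hle
    filter_upwards [hc'] with x hx
    rw [hx, hL0, zero_add]
  · intro hp
    have h0 : HasPrimitiveDeriv (fun x => (∫ y in Iic 0, H y) + ∫ y in (0 : ℝ)..x, H y) H :=
      ⟨_, ae_of_all _ fun x => rfl⟩
    have h1 := h0.mul_left (hexp (-l)) (hexpc (-l)) hHi
    have hval : ∀ᵐ x, ((Real.exp (-l * x) : ℝ) : ℂ) *
        ((∫ y in Iic 0, H y) + ∫ y in (0 : ℝ)..x, H y) = w x := by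
      filter_upwards [hp] with x hx
      rw [hx, hsplit x]
    refine h1.congr hval ?_
    filter_upwards [hval] with x hx
    rw [← hx]
    have h3 : ((Real.exp (-l * x) : ℝ) : ℂ) * ((Real.exp (l * x) : ℝ) : ℂ) = 1 := by
      rw [← Complex.ofReal_mul, ← Real.exp_add]; simp
    simp only [hH]
    rw [← mul_assoc (((Real.exp (-l * x) : ℝ) : ℂ)), h3]
    push_cast
    ring

/-- For square integrable `w` and `h`, the equation `w' + l w = h` holds if and only if `w` is the
image of `h` under the integral operator with kernel `freeKernel l`. -/
lemma hasPrimitiveDeriv_iff {l : ℝ} (hl : l ≠ 0) {w h : ℝ → ℂ} (hw : MemLp w 2)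
    (hh : MemLp h 2) :
    HasPrimitiveDeriv w (fun x => h x - l * w x) ↔
      ∀ᵐ x, w x = ∫ y, freeKernel l (x - y) * h y := by
  rcases lt_or_gt_of_ne hl with hneg | hpos
  · have hmp := Measure.measurePreserving_neg (volume : Measure ℝ)
    have hw' : MemLp (fun x => w (-x)) 2 := hw.comp_measurePreserving hmp
    have hh' : MemLp (fun x => -h (-x)) 2 := (hh.comp_measurePreserving hmp).neg
    have key := hasPrimitiveDeriv_iff_of_pos (l := -l) (by linarith) hw' hh'
    have h1 : HasPrimitiveDeriv (fun x => w (-x)) (fun x => -h (-x) - (-l : ℝ) * w (-x)) ↔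
        HasPrimitiveDeriv w (fun x => h x - l * w x) := by
      constructor
      · intro h
        have := h.comp_neg
        refine this.congr (ae_of_all _ fun x => by simp) (ae_of_all _ fun x => ?_)
        simp
        ring
      · intro h
        have := h.comp_neg
        refine this.congr (ae_of_all _ fun x => by simp) (ae_of_all _ fun x => ?_)
        simp
        ring
    have h2 : ∀ x, ∫ y, freeKernel (-l) (x - y) * -h (-y) =
        ∫ y, freeKernel l (-x - y) * h y := by
      intro x
      rw [← integral_neg_eq_self]
      congr 1
      funext y
      simp only [freeKernel, if_pos (show 0 < -l by linarith), if_neg (show ¬ 0 < l by linarith)]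
      ring_nf
    rw [← h1, key]
    simp only [h2]
    constructor
    · intro h
      filter_upwards [hmp.quasiMeasurePreserving.ae h] with x hx
      simpa using hx
    · intro h
      filter_upwards [hmp.quasiMeasurePreserving.ae h] with x hx
      simpa using hx
  · exact hasPrimitiveDeriv_iff_of_pos hpos hw hh

/-! ### Bounded operators from exponentially decaying kernels -/

lemma integrable_exp_neg_mul_abs {m : ℝ} (hm : 0 < m) :
    Integrable fun z : ℝ => Real.exp (-(m * |z|)) := by
  rw [← integrableOn_univ, ← Iic_union_Ioi (a := (0 : ℝ))]
  refine IntegrableOn.union ?_ ?_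
  · exact (integrableOn_exp_mul_Iic hm 0).congr_fun (fun z hz => by
      simp [abs_of_nonpos (show z ≤ 0 from hz)]) measurableSet_Iic
  · exact (exp_neg_integrableOn_Ioi 0 hm).congr_fun (fun z hz => by
      simp [abs_of_pos (show 0 < z from hz)]) measurableSet_Ioi

lemma memLp_two_exp_neg_mul_abs {m : ℝ} (hm : 0 < m) (x : ℝ) :
    MemLp (fun y : ℝ => Real.exp (-(m * |x - y|))) 2 := by
  refine (memLp_two_iff_integrable_sq (by fun_prop : Continuous _).aestronglyMeasurable).2 ?_
  have := (integrable_exp_neg_mul_abs (m := 2 * m) (by linarith)).comp_sub_left x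
  refine this.congr (ae_of_all _ fun y => ?_)
  simp only
  rw [← Real.exp_nat_mul]
  congr 1
  push_cast
  ring

/-- Cauchy–Schwarz for the splitting `k F = k^{1/2} · k^{1/2} F`. -/
lemma lintegral_mul_sq_le {α : Type*} [MeasurableSpace α] {μ : Measure α} {k F : α → ℝ≥0∞}
    (hk : AEMeasurable k μ) (hF : AEMeasurable F μ) :
    (∫⁻ y, k y * F y ∂μ) ^ (2 : ℝ) ≤ (∫⁻ y, k y ∂μ) * ∫⁻ y, k y * F y ^ (2 : ℝ) ∂μ := by
  have h := ENNReal.lintegral_mul_le_Lp_mul_Lq μ Real.HolderConjugate.two_two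
    (hk.pow_const (1 / 2 : ℝ)) ((hk.pow_const (1 / 2 : ℝ)).mul hF)
  have h1 : ∀ y, ((k y) ^ (1 / 2 : ℝ)) ^ (2 : ℝ) = k y := fun y => by
    rw [← ENNReal.rpow_mul]; norm_num
  have h2 : ∀ y, (k y) ^ (1 / 2 : ℝ) * ((k y) ^ (1 / 2 : ℝ) * F y) = k y * F y := fun y => by
    rw [← mul_assoc, ← ENNReal.rpow_add_of_nonneg _ _ (by norm_num) (by norm_num)]; norm_num
  simp only [Pi.mul_apply, h2, ENNReal.mul_rpow_of_nonneg _ _ (show (0 : ℝ) ≤ 2 by norm_num),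
    h1] at h
  calc _ ≤ _ := ENNReal.rpow_le_rpow h (by norm_num : (0 : ℝ) ≤ 2)
    _ = _ := by
      rw [ENNReal.mul_rpow_of_nonneg _ _ (by norm_num), ← ENNReal.rpow_mul, ← ENNReal.rpow_mul]
      norm_num

/-- Schur's test for kernels dominated by a convolution kernel. -/
lemma eLpNorm_lintegral_conv_le {k F : ℝ → ℝ≥0∞} (hk : Measurable k) (hF : AEMeasurable F) :
    ∫⁻ x, (∫⁻ y, k (x - y) * F y) ^ (2 : ℝ) ≤ (∫⁻ z, k z) ^ (2 : ℝ) * ∫⁻ y, F y ^ (2 : ℝ) := by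
  have hk1 : ∀ x, ∫⁻ y, k (x - y) = ∫⁻ z, k z := fun x => lintegral_sub_left_eq_self k x
  have hk2 : ∀ y, ∫⁻ x, k (x - y) = ∫⁻ z, k z := fun y => lintegral_sub_right_eq_self k y
  calc ∫⁻ x, (∫⁻ y, k (x - y) * F y) ^ (2 : ℝ)
      ≤ ∫⁻ x, (∫⁻ z, k z) * ∫⁻ y, k (x - y) * F y ^ (2 : ℝ) := by
        refine lintegral_mono fun x => ?_
        have := lintegral_mul_sq_le (k := fun y => k (x - y))
          (hk.comp (measurable_const.sub measurable_id)).aemeasurable hF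
        rwa [hk1] at this
    _ = (∫⁻ z, k z) * ∫⁻ x, ∫⁻ y, k (x - y) * F y ^ (2 : ℝ) := by
        refine lintegral_const_mul'' _ ?_
        refine AEMeasurable.lintegral_prod_right'
          (f := fun p : ℝ × ℝ => k (p.1 - p.2) * F p.2 ^ (2 : ℝ)) ?_
        exact (hk.comp (measurable_fst.sub measurable_snd)).aemeasurable.mul
          ((hF.comp_snd).pow_const _)
    _ = (∫⁻ z, k z) * ∫⁻ y, ∫⁻ x, k (x - y) * F y ^ (2 : ℝ) := by
        rw [lintegral_lintegral_swap]
        exact (hk.comp (measurable_fst.sub measurable_snd)).aemeasurable.mul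
          ((hF.comp_snd).pow_const _)
    _ = (∫⁻ z, k z) * ∫⁻ y, (∫⁻ z, k z) * F y ^ (2 : ℝ) := by
        congr 1
        refine lintegral_congr fun y => ?_
        rw [lintegral_mul_const _ (by fun_prop), hk2]
    _ = _ := by
        rw [lintegral_const_mul'' _ (hF.pow_const _), ← mul_assoc]
        norm_num [sq]

section Kernel

variable {K : ℝ → ℝ → ℂ} {C m : ℝ}

lemma integrable_kernel_mul (hm : 0 < m) (hK : Measurable (Function.uncurry K))
    (hb : ∀ x y, ‖K x y‖ ≤ C * Real.exp (-(m * |x - y|))) {f : ℝ → ℂ} (hf : MemLp f 2) (x : ℝ) :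
    Integrable fun y => K x y * f y := by
  have : MemLp (fun y => K x y) 2 :=
    ((memLp_two_exp_neg_mul_abs hm x).const_mul C).mono'
      (hK.comp measurable_prodMk_left).aestronglyMeasurable (ae_of_all _ (hb x))
  exact this.integrable_mul hf

/-- The kernel is dominated by convolution with `k(z) = C e^{-m|z|}`, so Schur's test applies with
`A = ∫ k`. -/
lemma exists_eLpNorm_kernel_le (hm : 0 < m) (hK : Measurable (Function.uncurry K))
    (hb : ∀ x y, ‖K x y‖ ≤ C * Real.exp (-(m * |x - y|))) :
    ∃ A : ℝ≥0∞, A ≠ ⊤ ∧ ∀ f : ℝ → ℂ, MemLp f 2 →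
      AEStronglyMeasurable (fun x => ∫ y, K x y * f y) ∧
      eLpNorm (fun x => ∫ y, K x y * f y) 2 ≤ A * eLpNorm f 2 := by
  set k : ℝ → ℝ≥0∞ := fun z => ENNReal.ofReal (C * Real.exp (-(m * |z|))) with hk
  have hkm : Measurable k := by fun_prop
  refine ⟨∫⁻ z, k z, ?_, fun f hf => ⟨?_, ?_⟩⟩
  · exact ((integrable_exp_neg_mul_abs hm).const_mul C).lintegral_lt_top.ne
  · refine AEStronglyMeasurable.integral_prod_right' (f := fun p : ℝ × ℝ => K p.1 p.2 * f p.2) ?_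
    exact hK.aestronglyMeasurable.mul hf.1.comp_snd
  · have h1 : ∀ x, ‖∫ y, K x y * f y‖ₑ ≤ ∫⁻ y, k (x - y) * ‖f y‖ₑ := fun x => by
      refine (enorm_integral_le_lintegral_enorm _).trans (lintegral_mono fun y => ?_)
      rw [enorm_mul]
      gcongr
      rw [← ofReal_norm]
      exact ENNReal.ofReal_le_ofReal (hb x y)
    have h2 : ∀ g : ℝ → ℂ, eLpNorm g 2 = (∫⁻ x, ‖g x‖ₑ ^ (2 : ℝ)) ^ (1 / 2 : ℝ) := fun g => by
      rw [eLpNorm_eq_lintegral_rpow_enorm_toReal (by norm_num) (by norm_num)]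
      norm_num
    rw [h2, h2]
    calc _ ≤ (∫⁻ x, (∫⁻ y, k (x - y) * ‖f y‖ₑ) ^ (2 : ℝ)) ^ (1 / 2 : ℝ) := by
          gcongr with x
          exact h1 x
      _ ≤ ((∫⁻ z, k z) ^ (2 : ℝ) * ∫⁻ y, ‖f y‖ₑ ^ (2 : ℝ)) ^ (1 / 2 : ℝ) := by
          gcongr
          exact eLpNorm_lintegral_conv_le hkm hf.1.enorm
      _ = _ := by
          rw [ENNReal.mul_rpow_of_nonneg _ _ (by norm_num), ← ENNReal.rpow_mul]
          norm_num

/-- A kernel with exponential off-diagonal decay defines a bounded operator on `L²(ℝ)`. -/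
lemma exists_scalar_operator (hm : 0 < m) (hK : Measurable (Function.uncurry K))
    (hb : ∀ x y, ‖K x y‖ ≤ C * Real.exp (-(m * |x - y|))) :
    ∃ T : Lp ℂ 2 (volume : Measure ℝ) →L[ℂ] Lp ℂ 2 (volume : Measure ℝ),
      ∀ f, T f =ᵐ[volume] fun x => ∫ y, K x y * f y := by
  obtain ⟨A, hA, hT⟩ := exists_eLpNorm_kernel_le hm hK hb
  have hmem : ∀ f : Lp ℂ 2 (volume : Measure ℝ), MemLp (fun x => ∫ y, K x y * f y) 2 := fun f =>
    ⟨(hT f (Lp.memLp f)).1, (hT f (Lp.memLp f)).2.trans_lt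
      (ENNReal.mul_lt_top hA.lt_top (Lp.memLp f).2)⟩
  have hint : ∀ (f : Lp ℂ 2 (volume : Measure ℝ)) x, Integrable fun y => K x y * f y := fun f x =>
    integrable_kernel_mul hm hK hb (Lp.memLp f) x
  refine ⟨LinearMap.mkContinuous
    { toFun := fun f => (hmem f).toLp _
      map_add' := fun f g => ?_
      map_smul' := fun c f => ?_ } A.toReal fun f => ?_, fun f => (hmem f).coeFn_toLp⟩
  · rw [← MemLp.toLp_add, MemLp.toLp_eq_toLp_iff]
    refine ae_of_all _ fun x => ?_
    simp only [Pi.add_apply]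
    rw [← integral_add (hint f x) (hint g x)]
    refine integral_congr_ae ?_
    filter_upwards [Lp.coeFn_add f g] with y hy
    rw [hy, Pi.add_apply, mul_add]
  · rw [RingHom.id_apply, ← MemLp.toLp_const_smul, MemLp.toLp_eq_toLp_iff]
    refine ae_of_all _ fun x => ?_
    simp only [Pi.smul_apply, smul_eq_mul]
    rw [← integral_const_mul]
    refine integral_congr_ae ?_
    filter_upwards [Lp.coeFn_smul c f] with y hy
    rw [hy, Pi.smul_apply, smul_eq_mul]
    ring
  · simp only [LinearMap.coe_mk, AddHom.coe_mk, Lp.norm_toLp]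
    rw [Lp.norm_def, ← ENNReal.toReal_mul]
    exact ENNReal.toReal_mono (ENNReal.mul_ne_top hA (Lp.memLp f).2.ne) (hT f (Lp.memLp f)).2

end Kernel

/-- A matrix kernel with exponential off-diagonal decay defines a bounded operator. -/
lemma exists_hasKernel {G : ℝ → ℝ → Matrix (Fin 2) (Fin 2) ℂ} {C m : ℝ} (hm : 0 < m)
    (hG : ∀ i j, Measurable (Function.uncurry fun x y => G x y i j))
    (hb : ∀ i j x y, ‖G x y i j‖ ≤ C * Real.exp (-(m * |x - y|))) : ∃ R, HasKernel R G := by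
  choose T hT using fun i j => exists_scalar_operator hm (hG i j) (hb i j)
  -- The matrix operator is assembled from four scalar ones through the coordinate projections `P`
  -- and the coordinate embeddings `S`.
  let P : Fin 2 → L2Pair →L[ℂ] Lp ℂ 2 (volume : Measure ℝ) := fun j =>
    (EuclideanSpace.proj j : EuclideanSpace ℂ (Fin 2) →L[ℂ] ℂ).compLpL 2 volume
  let S : Fin 2 → Lp ℂ 2 (volume : Measure ℝ) →L[ℂ] L2Pair := fun i =>
    (ContinuousLinearMap.toSpanSingleton ℂ
      (EuclideanSpace.single i (1 : ℂ) : EuclideanSpace ℂ (Fin 2))).compLpL 2 volume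
  have hP : ∀ j f, ∀ᵐ x, P j f x = f x j := fun j f =>
    ContinuousLinearMap.coeFn_compLp _ f
  have hS : ∀ i f, ∀ᵐ x, S i f x = f x • EuclideanSpace.single i (1 : ℂ) := fun i f =>
    ContinuousLinearMap.coeFn_compLp _ f
  have hint : ∀ (f : L2Pair) i j x, Integrable fun y => G x y i j * f y j := fun f i j x =>
    integrable_kernel_mul hm (hG i j) (hb i j) ((Lp.memLp f).eval_piLp j) x
  have hTP : ∀ i j f, ∀ᵐ x, T i j (P j f) x = ∫ y, G x y i j * f y j := by
    intro i j f
    filter_upwards [hT i j (P j f)] with x hx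
    rw [hx]
    refine integral_congr_ae ?_
    filter_upwards [hP j f] with y hy
    rw [hy]
  refine ⟨S 0 ∘L (T 0 0 ∘L P 0 + T 0 1 ∘L P 1) + S 1 ∘L (T 1 0 ∘L P 0 + T 1 1 ∘L P 1),
    fun f => ?_⟩
  simp only [_root_.add_apply, ContinuousLinearMap.comp_apply]
  filter_upwards [Lp.coeFn_add (S 0 (T 0 0 (P 0 f) + T 0 1 (P 1 f)))
      (S 1 (T 1 0 (P 0 f) + T 1 1 (P 1 f))), hS 0 (T 0 0 (P 0 f) + T 0 1 (P 1 f)),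
      hS 1 (T 1 0 (P 0 f) + T 1 1 (P 1 f)), Lp.coeFn_add (T 0 0 (P 0 f)) (T 0 1 (P 1 f)),
      Lp.coeFn_add (T 1 0 (P 0 f)) (T 1 1 (P 1 f)), hTP 0 0 f, hTP 0 1 f, hTP 1 0 f, hTP 1 1 f]
    with x h1 h2 h3 h4 h5 h6 h7 h8 h9 i
  refine ⟨((hint f i 0 x).add (hint f i 1 x)).congr (ae_of_all _ fun y => by simp), ?_⟩
  simp only [Fin.sum_univ_two]
  rw [integral_add (hint f i 0 x) (hint f i 1 x), h1, Pi.add_apply, h2, h3, h4, h5, Pi.add_apply,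
    Pi.add_apply, h6, h7, h8, h9]
  fin_cases i <;> simp

/-! ### Uniqueness of the Green's function -/

/-- Both kernels represent the same inverse, and their difference is continuous since the free parts
cancel. Testing on indicators of intervals with endpoints `0` and `β` shows that its integral over
such an interval vanishes for almost every `x`, hence for every `x` by continuity. Differentiation
in `β` concludes. -/
lemma IsGreenKernel.unique {κ : ℂ} {q : ℝ → ℂ} {G G' : ℝ → ℝ → Matrix (Fin 2) (Fin 2) ℂ}
    (hG : IsGreenKernel κ q G) (hG' : IsGreenKernel κ q G') : G = G' := by
  obtain ⟨⟨R, hR, hRG⟩, hc⟩ := hG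
  obtain ⟨⟨R', hR', hRG'⟩, hc'⟩ := hG'
  have hRR : ∀ f, R f = R' f := fun f => (hR' _ _).1 ((hR _ _).2 rfl)
  have hcont : ∀ i j, Continuous fun p : ℝ × ℝ => G p.1 p.2 i j - G' p.1 p.2 i j := by
    intro i j
    have := ((hc.sub hc').matrix_elem i j)
    simpa using this
  have hint : ∀ i j, ∀ x β : ℝ, ∫ y in (0 : ℝ)..β, (G x y i j - G' x y i j) = 0 := by
    intro i j x β
    revert x
    have hcx : Continuous fun x : ℝ => ∫ y in (0 : ℝ)..β, (G x y i j - G' x y i j) :=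
      intervalIntegral.continuous_parametric_intervalIntegral_of_continuous'
        (f := fun x y => G x y i j - G' x y i j) (hcont i j) 0 β
    rw [← funext_iff (g := fun _ => (0 : ℂ))]
    refine (Continuous.ae_eq_iff_eq volume hcx continuous_const).1 ?_
    have hm : MeasurableSet (uIoc 0 β) := measurableSet_uIoc
    have hfin : volume (uIoc (0 : ℝ) β) ≠ ⊤ := by
      rw [uIoc, Real.volume_Ioc]; exact ENNReal.ofReal_ne_top
    set f : L2Pair := indicatorConstLp 2 hm hfin (EuclideanSpace.single j (1 : ℂ))
    have hf : ∀ᵐ y : ℝ, f y = (uIoc 0 β).indicator (fun _ => EuclideanSpace.single j (1 : ℂ)) y :=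
      indicatorConstLp_coeFn
    filter_upwards [hRG f, hRG' f] with x h1 h2
    obtain ⟨i1, e1⟩ := h1 i
    obtain ⟨i2, e2⟩ := h2 i
    rw [hRR, e2, ← sub_eq_zero, ← integral_sub i2 i1] at e1
    rw [intervalIntegral.intervalIntegral_eq_integral_uIoc, ← integral_indicator hm]
    have : ∫ y, (uIoc 0 β).indicator (fun y => G x y i j - G' x y i j) y = 0 := by
      rw [← neg_eq_zero, ← integral_neg, ← e1]
      refine integral_congr_ae ?_
      filter_upwards [hf] with y hy
      rw [hy]
      by_cases hyβ : y ∈ uIoc 0 β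
      · simp only [indicator_of_mem hyβ]
        fin_cases j <;> simp
      · simp [indicator_of_notMem hyβ]
    rw [this, smul_zero]
  funext x y
  ext i j
  have hcy : Continuous fun y => G x y i j - G' x y i j :=
    (hcont i j).comp (continuous_const.prodMk continuous_id)
  have h1 : HasDerivAt (fun β => ∫ y in (0 : ℝ)..β, (G x y i j - G' x y i j))
      (G x y i j - G' x y i j) y :=
    intervalIntegral.integral_hasDerivAt_right (hcy.intervalIntegrable _ _)
      hcy.aestronglyMeasurable.stronglyMeasurableAtFilter hcy.continuousAt
  simp only [hint] at h1
  exact sub_eq_zero.1 (h1.unique (hasDerivAt_const y (0 : ℂ)))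

lemma greenKernel_eq {κ : ℂ} {q : ℝ → ℂ} {G : ℝ → ℝ → Matrix (Fin 2) (Fin 2) ℂ}
    (hG : IsGreenKernel κ q G) : greenKernel κ q = G := by
  have h : ∃ G, IsGreenKernel κ q G := ⟨G, hG⟩
  rw [greenKernel, dif_pos h]
  exact h.choose_spec.unique hG

/-! ### The jump of the free kernel -/

lemma measurable_step : Measurable step :=
  Measurable.ite measurableSet_Ioi measurable_const
    (Measurable.ite (measurableSet_singleton 0) measurable_const measurable_const)

lemma measurable_freeKernel (l : ℝ) : Measurable (freeKernel l) := by
  unfold freeKernel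
  split_ifs
  · exact Measurable.mul (by fun_prop) measurable_step
  · exact (Measurable.mul (by fun_prop) (measurable_step.comp measurable_neg)).neg

lemma step_eq_sign (z : ℝ) : step z = (((Real.sign z : ℝ) : ℂ) + 1) / 2 := by
  unfold step
  rcases lt_trichotomy z 0 with hz | rfl | hz
  · rw [if_neg hz.le.not_gt, if_neg hz.ne, Real.sign_of_neg hz]
    norm_num
  · simp
  · rw [if_pos hz, Real.sign_of_pos hz]
    norm_num

/-- This isolates the jump `sign z`, which is the same for `l` and `-l`, from the constant `sign l`.
It holds at `z = 0` too, thanks to `step 0 = 1/2`. -/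
lemma freeKernel_eq_sign {l : ℝ} (hl : l ≠ 0) (z : ℝ) : freeKernel l z =
    ((Real.exp (-(|l| * |z|)) : ℝ) : ℂ) / 2 * ((Real.sign z : ℝ) + (Real.sign l : ℝ)) := by
  unfold freeKernel
  rw [step_eq_sign, step_eq_sign, Real.sign_neg]
  rcases lt_or_gt_of_ne hl with h | h <;> rcases lt_trichotomy z 0 with hz | rfl | hz
  · rw [if_neg h.le.not_gt, abs_of_neg h, abs_of_neg hz, Real.sign_of_neg h,
      Real.sign_of_neg hz, neg_mul_neg, neg_mul]
    push_cast; ring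
  · rw [if_neg h.le.not_gt, Real.sign_of_neg h]
    simp
  · rw [if_neg h.le.not_gt, Real.sign_of_neg h, Real.sign_of_pos hz]
    norm_num
  · rw [if_pos h, Real.sign_of_pos h, Real.sign_of_neg hz]
    norm_num
  · rw [if_pos h, Real.sign_of_pos h]
    simp
  · rw [if_pos h, abs_of_pos h, abs_of_pos hz, Real.sign_of_pos h, Real.sign_of_pos hz, neg_mul]
    push_cast; ring

lemma norm_sign_le_one (z : ℝ) : ‖((Real.sign z : ℝ) : ℂ)‖ ≤ 1 := by
  rw [Complex.norm_real]
  rcases Real.sign_apply_eq z with h | h | h <;> simp [h]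

lemma norm_freeKernel_le {l : ℝ} (hl : l ≠ 0) (z : ℝ) :
    ‖freeKernel l z‖ ≤ Real.exp (-(|l| * |z|)) := by
  rw [freeKernel_eq_sign hl, norm_mul, norm_div, Complex.norm_real,
    Real.norm_of_nonneg (Real.exp_pos _).le]
  have := (norm_add_le ((Real.sign z : ℝ) : ℂ) ((Real.sign l : ℝ) : ℂ)).trans
    (add_le_add (norm_sign_le_one z) (norm_sign_le_one l))
  have h2 : ‖(2 : ℂ)‖ = 2 := by simp
  rw [h2]
  calc _ ≤ Real.exp (-(|l| * |z|)) / 2 * (1 + 1) := by gcongr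
    _ = _ := by ring

lemma freeGreen_eq {κ : ℂ} {k : ℝ} (hk : I * κ ^ 2 = k) (hk0 : k ≠ 0) (x y : ℝ) :
    freeGreen κ x y = !![freeKernel k (x - y), 0; 0, freeKernel (-k) (x - y)] := by
  have hneg : y - x = -(x - y) := by ring
  have hk1 : -k ≠ 0 := neg_ne_zero.2 hk0
  rw [freeGreen, hk, Complex.ofReal_re, freeKernel_eq_sign hk0, freeKernel_eq_sign hk1, abs_neg,
    step_eq_sign, step_eq_sign, hneg, Real.sign_neg]
  rcases lt_or_gt_of_ne hk0 with h | h
  · rw [if_neg h.le.not_gt, abs_of_neg h, Real.sign_of_neg h,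
      Real.sign_of_pos (neg_pos.2 h)]
    push_cast
    ext i j
    fin_cases i <;> fin_cases j <;> simp <;> ring
  · rw [if_pos h, abs_of_pos h, Real.sign_of_pos h, Real.sign_of_neg (neg_neg_of_pos h)]
    push_cast
    ext i j
    fin_cases i <;> fin_cases j <;> simp <;> ring

/-- A factor vanishing on the diagonal removes the jump of the sign there. -/
lemma continuous_sign_mul {H : ℝ × ℝ → ℂ} (hH : Continuous H) (h0 : ∀ x, H (x, x) = 0) :
    Continuous fun p : ℝ × ℝ => ((Real.sign (p.1 - p.2) : ℝ) : ℂ) * H p := by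
  rw [continuous_iff_continuousAt]
  rintro ⟨x, y⟩
  rcases lt_trichotomy (x - y) 0 with h | h | h
  · have hev : ∀ᶠ p : ℝ × ℝ in 𝓝 (x, y), p.1 - p.2 < 0 :=
      (continuous_fst.sub continuous_snd).continuousAt.eventually_lt_const h
    refine (hH.neg.continuousAt).congr (hev.mono fun p hp => ?_)
    simp [Real.sign_of_neg hp]
  · obtain rfl : x = y := by linarith
    rw [ContinuousAt]
    simp only [h0, mul_zero]
    refine squeeze_zero_norm (a := fun p => ‖H p‖) (fun p => ?_) ?_
    · rw [norm_mul]
      exact mul_le_of_le_one_left (norm_nonneg _) (norm_sign_le_one _)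
    · have := hH.norm.tendsto (x, x)
      rwa [h0, norm_zero] at this
  · have hev : ∀ᶠ p : ℝ × ℝ in 𝓝 (x, y), 0 < p.1 - p.2 :=
      (continuous_fst.sub continuous_snd).continuousAt.eventually_const_lt h
    refine (hH.continuousAt).congr (hev.mono fun p hp => ?_)
    simp [Real.sign_of_pos hp]

lemma memLp_bounded_mul {g f : ℝ → ℂ} (hg : Continuous g) {B : ℝ} (hB : ∀ x, ‖g x‖ ≤ B)
    (hf : MemLp f 2) : MemLp (fun x => g x * f x) 2 :=
  hf.of_le_mul (hg.aestronglyMeasurable.mul hf.1) (ae_of_all _ fun x => by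
    rw [norm_mul]; exact mul_le_mul_of_nonneg_right (hB x) (norm_nonneg _))

/-! ### Frames and the Green's functions they generate -/

/-- The columns of `[[a, c], [b, d]]` times `exp (-k x)`, `exp (k x)` solve `L(κ) ψ = 0`, and the
matrix is bounded with determinant one. -/
structure IsFrame (κ : ℂ) (k : ℝ) (q a b c d : ℝ → ℂ) : Prop where
  continuous_q : Continuous q
  bound_q : ∃ B, ∀ x, ‖q x‖ ≤ B
  deriv_a : ∀ x, HasDerivAt a (κ * q x * b x) x
  deriv_b : ∀ x, HasDerivAt b (2 * k * b x + κ * negConj q x * a x) x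
  deriv_c : ∀ x, HasDerivAt c (-2 * k * c x + κ * q x * d x) x
  deriv_d : ∀ x, HasDerivAt d (κ * negConj q x * c x) x
  det_eq_one : ∀ x, a x * d x - b x * c x = 1
  bound : ∃ B, ∀ x, ‖a x‖ ≤ B ∧ ‖b x‖ ≤ B ∧ ‖c x‖ ≤ B ∧ ‖d x‖ ≤ B

lemma continuous_negConj {q : ℝ → ℂ} (hq : Continuous q) : Continuous (negConj q) :=
  (Complex.continuous_conj.comp hq).neg

lemma norm_negConj (q : ℝ → ℂ) (x : ℝ) : ‖negConj q x‖ = ‖q x‖ := by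
  simp [negConj]

lemma HasPrimitiveDeriv.linear_combination {g₁ g₁' g₂ g₂' u₁ v₁ u₂ v₂ : ℝ → ℂ}
    (h₁ : HasPrimitiveDeriv u₁ v₁) (h₂ : HasPrimitiveDeriv u₂ v₂)
    (hg₁ : ∀ x, HasDerivAt g₁ (g₁' x) x) (hg₂ : ∀ x, HasDerivAt g₂ (g₂' x) x)
    (hg₁' : Continuous g₁') (hg₂' : Continuous g₂') (hu₁ : MemLp u₁ 2) (hu₂ : MemLp u₂ 2)
    (hv₁ : MemLp v₁ 2) (hv₂ : MemLp v₂ 2) :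
    HasPrimitiveDeriv (fun x => g₁ x * u₁ x + g₂ x * u₂ x)
      (fun x => (g₁' x * u₁ x + g₁ x * v₁ x) + (g₂' x * u₂ x + g₂ x * v₂ x)) := by
  have hc₁ : Continuous g₁ := continuous_iff_continuousAt.2 fun x => (hg₁ x).continuousAt
  have hc₂ : Continuous g₂ := continuous_iff_continuousAt.2 fun x => (hg₂ x).continuousAt
  have hli : ∀ {f : ℝ → ℂ}, MemLp f 2 → LocallyIntegrable f := fun hf =>
    hf.locallyIntegrable (by norm_num)
  exact (h₁.mul_left hg₁ hg₁' (hli hv₁)).add (h₂.mul_left hg₂ hg₂' (hli hv₂))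
    ((locallyIntegrable_continuous_mul hg₁' (hli hu₁)).add
      (locallyIntegrable_continuous_mul hc₁ (hli hv₁)))
    ((locallyIntegrable_continuous_mul hg₂' (hli hu₂)).add
      (locallyIntegrable_continuous_mul hc₂ (hli hv₂)))

/-- The equation determines the derivative `v` from `u` and `f`, and `v` is automatically in `L²`
because `q` is bounded; so it can be eliminated. -/
lemma laxEq_iff {κ : ℂ} {k : ℝ} (hk : I * κ ^ 2 = k) {q : ℝ → ℂ} (hq : Continuous q)
    (hqb : ∃ B, ∀ x, ‖q x‖ ≤ B) (u f : L2Pair) :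
    LaxEq κ q u f ↔
      HasPrimitiveDeriv (fun x => u x 0) (fun x => f x 0 - k * u x 0 + κ * q x * u x 1) ∧
      HasPrimitiveDeriv (fun x => u x 1)
        (fun x => f x 1 + k * u x 1 + κ * negConj q x * u x 0) := by
  obtain ⟨B, hB⟩ := hqb
  have hB' : ∀ x, ‖κ * q x‖ ≤ ‖κ‖ * B := fun x => by rw [norm_mul]; gcongr; exact hB x
  have hB'' : ∀ x, ‖κ * negConj q x‖ ≤ ‖κ‖ * B := fun x => by
    rw [norm_mul, norm_negConj]; gcongr; exact hB x
  have hu : ∀ i, MemLp (fun x => u x i) 2 := (Lp.memLp u).eval_piLp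
  have hf : ∀ i, MemLp (fun x => f x i) 2 := (Lp.memLp f).eval_piLp
  constructor
  · rintro ⟨v, hv, h0, h1⟩
    refine ⟨(hv 0).congr EventuallyEq.rfl ?_, (hv 1).congr EventuallyEq.rfl ?_⟩
    · filter_upwards [h0] with x hx
      rw [hx, hk]; ring
    · filter_upwards [h1] with x hx
      rw [hx, hk]; ring
  · rintro ⟨h0, h1⟩
    set w : ℝ → EuclideanSpace ℂ (Fin 2) := fun x => WithLp.toLp 2
      ![f x 0 - k * u x 0 + κ * q x * u x 1, f x 1 + k * u x 1 + κ * negConj q x * u x 0]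
    have hw : MemLp w 2 := by
      refine MemLp.of_eval_piLp fun i => ?_
      fin_cases i
      · exact ((hf 0).sub ((hu 0).const_mul _)).add
          (memLp_bounded_mul (continuous_const.mul hq) hB' (hu 1))
      · exact ((hf 1).add ((hu 1).const_mul _)).add
          (memLp_bounded_mul (continuous_const.mul (continuous_negConj hq)) hB'' (hu 0))
    have hwc := hw.coeFn_toLp
    refine ⟨hw.toLp w, fun i => ?_, ?_, ?_⟩
    · fin_cases i
      · refine h0.congr EventuallyEq.rfl ?_
        filter_upwards [hwc] with x hx
        simp [hx, w]
      · refine h1.congr EventuallyEq.rfl ?_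
        filter_upwards [hwc] with x hx
        simp [hx, w]
    · filter_upwards [hwc] with x hx
      rw [hx, hk]
      simp [w]
      ring
    · filter_upwards [hwc] with x hx
      rw [hx, hk]
      simp [w]

/-- The Green's function obtained by conjugating the free one with a frame. -/
noncomputable def frameGreen (κ : ℂ) (a b c d : ℝ → ℂ) (x y : ℝ) : Matrix (Fin 2) (Fin 2) ℂ :=
  !![a x, c x; b x, d x] * freeGreen κ x y * !![d y, -c y; -b y, a y]

namespace IsFrame

variable {κ : ℂ} {k : ℝ} {q a b c d : ℝ → ℂ}

lemma continuous (h : IsFrame κ k q a b c d) :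
    Continuous a ∧ Continuous b ∧ Continuous c ∧ Continuous d :=
  ⟨continuous_iff_continuousAt.2 fun x => (h.deriv_a x).continuousAt,
    continuous_iff_continuousAt.2 fun x => (h.deriv_b x).continuousAt,
    continuous_iff_continuousAt.2 fun x => (h.deriv_c x).continuousAt,
    continuous_iff_continuousAt.2 fun x => (h.deriv_d x).continuousAt⟩

lemma frameGreen_apply (hk : I * κ ^ 2 = k) (hk0 : k ≠ 0) (x y : ℝ) (i j : Fin 2) :
    frameGreen κ a b c d x y i j =
      ![a x, b x] i * freeKernel k (x - y) * ![d y, -c y] j +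
      ![c x, d x] i * freeKernel (-k) (x - y) * ![-b y, a y] j := by
  rw [frameGreen, freeGreen_eq hk hk0]
  fin_cases i <;> fin_cases j <;> simp [Matrix.mul_apply, Fin.sum_univ_two]

/-- The frame conjugates the Lax operator to the free one. -/
lemma hasPrimitiveDeriv_iff (h : IsFrame κ k q a b c d) {u₀ u₁ f₀ f₁ : ℝ → ℂ}
    (hu₀ : MemLp u₀ 2) (hu₁ : MemLp u₁ 2) (hf₀ : MemLp f₀ 2) (hf₁ : MemLp f₁ 2) :
    (HasPrimitiveDeriv u₀ (fun x => f₀ x - k * u₀ x + κ * q x * u₁ x) ∧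
      HasPrimitiveDeriv u₁ (fun x => f₁ x + k * u₁ x + κ * negConj q x * u₀ x)) ↔
    (HasPrimitiveDeriv (fun x => d x * u₀ x + -c x * u₁ x)
        (fun x => (d x * f₀ x + -c x * f₁ x) - k * (d x * u₀ x + -c x * u₁ x)) ∧
      HasPrimitiveDeriv (fun x => -b x * u₀ x + a x * u₁ x)
        (fun x => (-b x * f₀ x + a x * f₁ x) - (-k : ℝ) * (-b x * u₀ x + a x * u₁ x))) := by
  obtain ⟨ca, cb, cc, cd⟩ := h.continuous
  have cq := h.continuous_q
  have cr := continuous_negConj cq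
  obtain ⟨B, hB⟩ := h.bound_q
  obtain ⟨A, hA⟩ := h.bound
  have hB' : ∀ x, ‖κ * q x‖ ≤ ‖κ‖ * B := fun x => by rw [norm_mul]; gcongr; exact hB x
  have hB'' : ∀ x, ‖κ * negConj q x‖ ≤ ‖κ‖ * B := fun x => by
    rw [norm_mul, norm_negConj]; gcongr; exact hB x
  have hd' : Continuous fun x => κ * negConj q x * c x := by fun_prop
  have hc' : Continuous fun x => -(-2 * k * c x + κ * q x * d x) := by fun_prop
  have hb' : Continuous fun x => -(2 * k * b x + κ * negConj q x * a x) := by fun_prop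
  have ha' : Continuous fun x => κ * q x * b x := by fun_prop
  have hcn : ∀ x, ‖-c x‖ ≤ A := fun x => by rw [norm_neg]; exact (hA x).2.2.1
  have hbn : ∀ x, ‖-b x‖ ≤ A := fun x => by rw [norm_neg]; exact (hA x).2.1
  constructor
  · rintro ⟨h0, h1⟩
    have hv₀ : MemLp (fun x => f₀ x - k * u₀ x + κ * q x * u₁ x) 2 :=
      (hf₀.sub (hu₀.const_mul _)).add (memLp_bounded_mul (continuous_const.mul cq) hB' hu₁)
    have hv₁ : MemLp (fun x => f₁ x + k * u₁ x + κ * negConj q x * u₀ x) 2 :=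
      (hf₁.add (hu₁.const_mul _)).add (memLp_bounded_mul (continuous_const.mul cr) hB'' hu₀)
    constructor
    · refine (h0.linear_combination h1 h.deriv_d (fun x => (h.deriv_c x).neg) hd' hc' hu₀ hu₁ hv₀
        hv₁).congr EventuallyEq.rfl (ae_of_all _ fun x => ?_)
      simp only [Pi.neg_apply]
      ring
    · refine (h0.linear_combination h1 (fun x => (h.deriv_b x).neg) h.deriv_a hb' ha' hu₀ hu₁ hv₀
        hv₁).congr EventuallyEq.rfl (ae_of_all _ fun x => ?_)
      simp only [Pi.neg_apply]
      push_cast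
      ring
  -- The converse applies `M` to the transformed equations; `det M = 1` gives `M M⁻¹ = 1`.
  · rintro ⟨h0, h1⟩
    have hy₀ : MemLp (fun x => d x * u₀ x + -c x * u₁ x) 2 :=
      (memLp_bounded_mul cd (fun x => (hA x).2.2.2) hu₀).add (memLp_bounded_mul cc.neg hcn hu₁)
    have hy₁ : MemLp (fun x => -b x * u₀ x + a x * u₁ x) 2 :=
      (memLp_bounded_mul cb.neg hbn hu₀).add (memLp_bounded_mul ca (fun x => (hA x).1) hu₁)
    have hh₀ : MemLp (fun x => d x * f₀ x + -c x * f₁ x) 2 :=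
      (memLp_bounded_mul cd (fun x => (hA x).2.2.2) hf₀).add (memLp_bounded_mul cc.neg hcn hf₁)
    have hh₁ : MemLp (fun x => -b x * f₀ x + a x * f₁ x) 2 :=
      (memLp_bounded_mul cb.neg hbn hf₀).add (memLp_bounded_mul ca (fun x => (hA x).1) hf₁)
    constructor
    · refine (h0.linear_combination h1 h.deriv_a h.deriv_c ha' (by fun_prop) hy₀ hy₁
        (hh₀.sub (hy₀.const_mul _)) (hh₁.sub (hy₁.const_mul _))).congr
        (ae_of_all _ fun x => ?_) (ae_of_all _ fun x => ?_)
      · linear_combination u₀ x * h.det_eq_one x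
      · push_cast
        linear_combination (f₀ x - k * u₀ x + κ * q x * u₁ x) * h.det_eq_one x
    · refine (h0.linear_combination h1 h.deriv_b h.deriv_d (by fun_prop) (by fun_prop) hy₀ hy₁
        (hh₀.sub (hy₀.const_mul _)) (hh₁.sub (hy₁.const_mul _))).congr
        (ae_of_all _ fun x => ?_) (ae_of_all _ fun x => ?_)
      · linear_combination u₁ x * h.det_eq_one x
      · push_cast
        linear_combination (f₁ x + k * u₁ x + κ * negConj q x * u₀ x) * h.det_eq_one x

lemma exists_hasKernel_frameGreen (h : IsFrame κ k q a b c d) (hk : I * κ ^ 2 = k)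
    (hk0 : k ≠ 0) : ∃ R, HasKernel R (frameGreen κ a b c d) := by
  obtain ⟨ca, cb, cc, cd⟩ := h.continuous
  obtain ⟨A, hA⟩ := h.bound
  have hA0 : 0 ≤ A := (norm_nonneg _).trans (hA 0).1
  refine exists_hasKernel (C := 2 * A ^ 2) (m := |k|) (abs_pos.2 hk0) (fun i j => ?_)
    (fun i j x y => ?_)
  · simp only [frameGreen_apply hk hk0]
    have m0 : Measurable fun p : ℝ × ℝ => freeKernel k (p.1 - p.2) :=
      (measurable_freeKernel k).comp (measurable_fst.sub measurable_snd)
    have m1 : Measurable fun p : ℝ × ℝ => freeKernel (-k) (p.1 - p.2) :=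
      (measurable_freeKernel (-k)).comp (measurable_fst.sub measurable_snd)
    have ma := ca.measurable
    have mb := cb.measurable
    have mc := cc.measurable
    have md := cd.measurable
    unfold Function.uncurry
    fin_cases i <;> fin_cases j <;> simp <;> fun_prop
  · rw [frameGreen_apply hk hk0]
    have n0 := norm_freeKernel_le hk0 (x - y)
    have n1 := norm_freeKernel_le (neg_ne_zero.2 hk0) (x - y)
    rw [abs_neg] at n1
    have n2 : ‖![a x, b x] i‖ ≤ A := by
      fin_cases i
      exacts [(hA x).1, (hA x).2.1]
    have n3 : ‖![c x, d x] i‖ ≤ A := by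
      fin_cases i
      exacts [(hA x).2.2.1, (hA x).2.2.2]
    have n4 : ‖![d y, -c y] j‖ ≤ A := by
      fin_cases j
      exacts [(hA y).2.2.2, by simpa using (hA y).2.2.1]
    have n5 : ‖![-b y, a y] j‖ ≤ A := by
      fin_cases j
      exacts [by simpa using (hA y).2.1, (hA y).1]
    set e := Real.exp (-(|k| * |x - y|))
    refine (norm_add_le _ _).trans ?_
    simp only [norm_mul]
    calc _ ≤ A * e * A + A * e * A := by gcongr
      _ = _ := by ring

/-- In the unknowns `M⁻¹ u` with data `M⁻¹ f` the system decouples into the scalar equations for `∂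
+ k` and `∂ - k`, each equivalent to its integral formula. Multiplying back by `M(x)` gives the
kernel. -/
lemma isResolvent (h : IsFrame κ k q a b c d) (hk : I * κ ^ 2 = k) (hk0 : k ≠ 0)
    {R : L2Pair →L[ℂ] L2Pair} (hR : HasKernel R (frameGreen κ a b c d)) : IsResolvent κ q R := by
  obtain ⟨ca, cb, cc, cd⟩ := h.continuous
  obtain ⟨A, hA⟩ := h.bound
  have hcn : ∀ x, ‖-c x‖ ≤ A := fun x => by rw [norm_neg]; exact (hA x).2.2.1
  have hbn : ∀ x, ‖-b x‖ ≤ A := fun x => by rw [norm_neg]; exact (hA x).2.1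
  intro u f
  have hu : ∀ i, MemLp (fun x => u x i) 2 := (Lp.memLp u).eval_piLp
  have hf : ∀ i, MemLp (fun x => f x i) 2 := (Lp.memLp f).eval_piLp
  have hy₀ : MemLp (fun x => d x * u x 0 + -c x * u x 1) 2 :=
    (memLp_bounded_mul cd (fun x => (hA x).2.2.2) (hu 0)).add
      (memLp_bounded_mul cc.neg hcn (hu 1))
  have hy₁ : MemLp (fun x => -b x * u x 0 + a x * u x 1) 2 :=
    (memLp_bounded_mul cb.neg hbn (hu 0)).add
      (memLp_bounded_mul ca (fun x => (hA x).1) (hu 1))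
  have hh₀ : MemLp (fun x => d x * f x 0 + -c x * f x 1) 2 :=
    (memLp_bounded_mul cd (fun x => (hA x).2.2.2) (hf 0)).add
      (memLp_bounded_mul cc.neg hcn (hf 1))
  have hh₁ : MemLp (fun x => -b x * f x 0 + a x * f x 1) 2 :=
    (memLp_bounded_mul cb.neg hbn (hf 0)).add
      (memLp_bounded_mul ca (fun x => (hA x).1) (hf 1))
  rw [laxEq_iff hk h.continuous_q h.bound_q, h.hasPrimitiveDeriv_iff (hu 0) (hu 1) (hf 0) (hf 1),
    DNLS.hasPrimitiveDeriv_iff hk0 hy₀ hh₀,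
    DNLS.hasPrimitiveDeriv_iff (neg_ne_zero.2 hk0) hy₁ hh₁]
  have hint : ∀ {l : ℝ} (_ : l ≠ 0) {g : ℝ → ℂ} (_ : MemLp g 2) (x : ℝ),
      Integrable fun y => freeKernel l (x - y) * g y := fun {l} hl {g} hg x =>
    integrable_kernel_mul (K := fun x y => freeKernel l (x - y)) (abs_pos.2 hl)
      ((measurable_freeKernel l).comp (measurable_fst.sub measurable_snd))
      (fun x y => by simpa using norm_freeKernel_le hl (x - y)) (C := 1) hg x
  have hval : ∀ x i, ∫ y, ∑ j, frameGreen κ a b c d x y i j * f y j =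
      ![a x, b x] i * (∫ y, freeKernel k (x - y) * (d y * f y 0 + -c y * f y 1)) +
      ![c x, d x] i * (∫ y, freeKernel (-k) (x - y) * (-b y * f y 0 + a y * f y 1)) := by
    intro x i
    rw [← integral_const_mul, ← integral_const_mul, ← integral_add
      ((hint hk0 hh₀ x).const_mul _) ((hint (neg_ne_zero.2 hk0) hh₁ x).const_mul _)]
    congr 1
    funext y
    simp only [Fin.sum_univ_two, frameGreen_apply hk hk0, Matrix.cons_val_zero,
      Matrix.cons_val_one]
    ring
  have hRx := hR f
  constructor
  · rintro ⟨h0, h1⟩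
    refine Lp.ext ?_
    filter_upwards [h0, h1, hRx] with x e0 e1 e2
    ext i
    rw [(e2 i).2, hval, ← e0, ← e1]
    fin_cases i
    · simp
      linear_combination (-u x 0) * h.det_eq_one x
    · simp
      linear_combination (-u x 1) * h.det_eq_one x
  · rintro rfl
    constructor
    · filter_upwards [hRx] with x e2
      rw [(e2 0).2, (e2 1).2, hval, hval]
      simp only [Matrix.cons_val_zero, Matrix.cons_val_one]
      linear_combination
        (∫ y, freeKernel k (x - y) * (d y * f y 0 + -c y * f y 1)) * h.det_eq_one x
    · filter_upwards [hRx] with x e2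
      rw [(e2 0).2, (e2 1).2, hval, hval]
      simp only [Matrix.cons_val_zero, Matrix.cons_val_one]
      linear_combination
        (∫ y, freeKernel (-k) (x - y) * (-b y * f y 0 + a y * f y 1)) * h.det_eq_one x

/-- Each entry splits into `sign (x - y)` times `e (P + Q)` and a continuous multiple of `P - Q`. On
the diagonal `P + Q` is an entry of `M M⁻¹ - 1 = 0`, so the jump disappears. -/
lemma continuous_frameGreen_sub (h : IsFrame κ k q a b c d) (hk : I * κ ^ 2 = k) (hk0 : k ≠ 0) :
    Continuous fun p : ℝ × ℝ => frameGreen κ a b c d p.1 p.2 - freeGreen κ p.1 p.2 := by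
  obtain ⟨ca, cb, cc, cd⟩ := h.continuous
  set e : ℝ × ℝ → ℂ := fun p => ((Real.exp (-(|k| * |p.1 - p.2|)) : ℝ) : ℂ) / 2 with he
  have hec : Continuous e := by fun_prop
  set σ : ℂ := ((Real.sign k : ℝ) : ℂ)
  have hfk : ∀ x y, freeKernel k (x - y) = e (x, y) * ((Real.sign (x - y) : ℝ) + σ) := fun x y =>
    freeKernel_eq_sign hk0 _
  have hfk' : ∀ x y, freeKernel (-k) (x - y) = e (x, y) * ((Real.sign (x - y) : ℝ) - σ) :=
    fun x y => by
      rw [freeKernel_eq_sign (neg_ne_zero.2 hk0), abs_neg, Real.sign_neg]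
      simp only [he, σ]
      push_cast
      ring
  refine continuous_matrix fun i j => ?_
  set P : ℝ × ℝ → ℂ := fun p => ![a p.1, b p.1] i * ![d p.2, -c p.2] j - ![1, 0] i * ![1, 0] j
    with hP
  set Q : ℝ × ℝ → ℂ := fun p => ![c p.1, d p.1] i * ![-b p.2, a p.2] j - ![0, 1] i * ![0, 1] j
    with hQ
  have hPc : Continuous P := by
    rw [hP]
    fin_cases i <;> fin_cases j <;> simp <;> fun_prop
  have hQc : Continuous Q := by
    rw [hQ]
    fin_cases i <;> fin_cases j <;> simp <;> fun_prop
  have hPQ : ∀ x, e (x, x) * (P (x, x) + Q (x, x)) = 0 := by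
    intro x
    have hdet := h.det_eq_one x
    rw [mul_eq_zero]
    right
    fin_cases i <;> fin_cases j <;> simp [hP, hQ]
    · linear_combination hdet
    · ring
    · ring
    · linear_combination hdet
  have hsum := (continuous_sign_mul (hec.mul (hPc.add hQc)) hPQ).add
    ((continuous_const (y := σ)).mul (hec.mul (hPc.sub hQc)))
  refine hsum.congr fun p => ?_
  obtain ⟨x, y⟩ := p
  simp only [Matrix.sub_apply, frameGreen_apply hk hk0, freeGreen_eq hk hk0, hfk, hfk', hP, hQ]
  fin_cases i <;> fin_cases j <;> simp <;> ring

theorem isGreenKernel (h : IsFrame κ k q a b c d) (hk : I * κ ^ 2 = k) (hk0 : k ≠ 0) :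
    IsGreenKernel κ q (frameGreen κ a b c d) := by
  obtain ⟨R, hR⟩ := h.exists_hasKernel_frameGreen hk hk0
  exact ⟨⟨R, h.isResolvent hk hk0 hR, hR⟩, h.continuous_frameGreen_sub hk hk0⟩

/-- On the diagonal the free kernels equal `± sign k / 2`, so `G(x, x) = (sign k / 2) M diag(1, -1)
M⁻¹`; the normalizing factor `sgn κ` squares the sign away. -/
lemma diagonal_values (h : IsFrame κ k q a b c d) (hk : I * κ ^ 2 = k) (hk0 : k ≠ 0) (x : ℝ) :
    gam κ q x = a x * d x + b x * c x - 1 ∧ g12 κ q x = -(a x * c x) ∧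
      g21 κ q x = b x * d x := by
  have hσ : ((Real.sign k : ℝ) : ℂ) * ((Real.sign k : ℝ) : ℂ) = 1 := by
    rcases lt_or_gt_of_ne hk0 with h | h
    · simp [Real.sign_of_neg h]
    · simp [Real.sign_of_pos h]
  have hf : freeKernel k 0 = ((Real.sign k : ℝ) : ℂ) / 2 := by
    rw [freeKernel_eq_sign hk0]
    simp
    ring
  have hf' : freeKernel (-k) 0 = -(((Real.sign k : ℝ) : ℂ) / 2) := by
    rw [freeKernel_eq_sign (neg_ne_zero.2 hk0), Real.sign_neg]
    simp
    ring
  unfold gam g12 g21 sgn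
  rw [greenKernel_eq (h.isGreenKernel hk hk0), hk, Complex.ofReal_re]
  simp only [frameGreen_apply hk hk0, sub_self, hf, hf', Matrix.cons_val_zero, Matrix.cons_val_one]
  refine ⟨?_, ?_, ?_⟩
  · linear_combination (a x * d x + b x * c x) * hσ
  · linear_combination (-(a x * c x)) * hσ
  · linear_combination (b x * d x) * hσ

end IsFrame

/-! ### From Riccati solutions to frames -/

namespace IsRiccati

variable {κ : ℂ} {k : ℝ} {q u v : ℝ → ℂ}

lemma continuous {l : ℝ} {p s u : ℝ → ℂ} (h : IsRiccati l p s u) : Continuous u :=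
  continuous_iff_continuousAt.2 fun x => (h.2 x).continuousAt

lemma one_sub_mul_ne_zero {l l' : ℝ} {p p' s s' : ℝ → ℂ} (hu : IsRiccati l p s u)
    (hv : IsRiccati l' p' s' v) (x : ℝ) :
    3 / 4 ≤ ‖1 - u x * v x‖ ∧ 1 - u x * v x ≠ 0 := by
  have h1 : ‖u x * v x‖ ≤ 1 / 2 * (1 / 2) := by
    rw [norm_mul]
    gcongr
    exacts [hu.1 x, hv.1 x]
  have h2 : ‖(1 : ℂ)‖ ≤ ‖1 - u x * v x‖ + ‖u x * v x‖ := by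
    simpa using norm_add_le (1 - u x * v x) (u x * v x)
  rw [norm_one] at h2
  have h3 : 3 / 4 ≤ ‖1 - u x * v x‖ := by linarith
  exact ⟨h3, norm_pos_iff.1 (by linarith)⟩

/-- Bounded Riccati solutions of both signs give a frame. -/
lemma exists_isFrame (hqc : Continuous q) (hqb : ∃ B, ∀ x, ‖q x‖ ≤ B) (hqi : Integrable q)
    (hu : IsRiccati (2 * k) (fun x => κ * negConj q x) (fun x => κ * q x) u)
    (hv : IsRiccati (-2 * k) (fun x => κ * q x) (fun x => κ * negConj q x) v) :
    ∃ a b c d, IsFrame κ k q a b c d ∧ ∀ x, b x = a x * u x ∧ c x = d x * v x := by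
  have hqu : Continuous fun x => q x * u x := hqc.mul hu.continuous
  -- With `b = a u` the equation for `a` is `a' = κ q u a`, solved by `exp F`. Integrability of `q`
  -- bounds `F`, hence the frame.
  set F : ℝ → ℂ := fun x => κ * ∫ y in (0 : ℝ)..x, q y * u y with hF
  have hFd : ∀ x, HasDerivAt F (κ * (q x * u x)) x := fun x =>
    (intervalIntegral.integral_hasDerivAt_right (hqu.intervalIntegrable _ _)
      hqu.aestronglyMeasurable.stronglyMeasurableAtFilter hqu.continuousAt).const_mul κ
  have hFb : ∀ x, ‖F x‖ ≤ ‖κ‖ * ∫ y, ‖q y‖ := by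
    intro x
    simp only [hF]
    rw [norm_mul]
    gcongr
    refine (intervalIntegral.norm_integral_le_integral_norm_uIoc).trans ?_
    refine (integral_mono_of_nonneg (ae_of_all _ fun y => norm_nonneg _)
      hqi.norm.integrableOn (ae_of_all _ fun y => ?_)).trans
      (setIntegral_le_integral hqi.norm (ae_of_all _ fun y => norm_nonneg _))
    simp only
    rw [norm_mul]
    exact mul_le_of_le_one_right (norm_nonneg _) ((hu.1 y).trans (by norm_num))
  set M := Real.exp (‖κ‖ * ∫ y, ‖q y‖)
  set a : ℝ → ℂ := fun x => Complex.exp (F x) with ha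
  -- Forced by `det M = a d (1 - u v) = 1`. Its equation then follows from both Riccati equations,
  -- since the terms `±2k u v` cancel in `(u v)'`.
  set d : ℝ → ℂ := fun x => Complex.exp (-F x) * (1 - u x * v x)⁻¹ with hd
  have hne := one_sub_mul_ne_zero hu hv
  have had : ∀ x, HasDerivAt a (a x * (κ * (q x * u x))) x := fun x => (hFd x).cexp
  have hdd : ∀ x, HasDerivAt d (κ * negConj q x * (d x * v x)) x := by
    intro x
    have h1 := ((hu.2 x).mul (hv.2 x)).const_sub 1
    have h2 := ((hFd x).neg.cexp).mul (h1.inv (hne x).2)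
    convert! h2 using 1
    have := (hne x).2
    simp only [hd, Pi.mul_apply, Pi.neg_apply, Pi.inv_apply]
    field_simp
    push_cast
    ring
  have hae : ∀ x, ‖a x‖ ≤ M := fun x => by
    rw [ha, Complex.norm_exp]
    exact Real.exp_le_exp.2 ((Complex.re_le_norm _).trans (hFb x))
  have hM : 0 < M := Real.exp_pos _
  have hde : ∀ x, ‖d x‖ ≤ 2 * M := fun x => by
    simp only [hd]
    have h1 : ‖Complex.exp (-F x)‖ ≤ M := by
      rw [Complex.norm_exp]
      exact Real.exp_le_exp.2 ((Complex.re_le_norm _).trans (by rw [norm_neg]; exact hFb x))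
    have h2 : ‖1 - u x * v x‖⁻¹ ≤ 2 :=
      (inv_anti₀ (by norm_num) (hne x).1).trans (by norm_num)
    rw [norm_mul, norm_inv, mul_comm 2]
    gcongr
  refine ⟨a, fun x => a x * u x, fun x => d x * v x, d,
    ⟨hqc, hqb, fun x => ?_, fun x => ?_, fun x => ?_, hdd, fun x => ?_, 2 * M, fun x =>
      ⟨(hae x).trans (by linarith), ?_, ?_, hde x⟩⟩, fun x => ⟨rfl, rfl⟩⟩
  · convert! had x using 1
    ring
  · convert! (had x).mul (hu.2 x) using 1
    push_cast
    ring
  · convert! (hdd x).mul (hv.2 x) using 1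
    push_cast
    ring
  · have := (hne x).2
    simp only [ha, hd]
    have h1 : Complex.exp (F x) * Complex.exp (-F x) = 1 := by
      rw [← Complex.exp_add]; simp
    field_simp
    linear_combination h1
  · rw [norm_mul]
    calc ‖a x‖ * ‖u x‖ ≤ M * (1 / 2) := by
          gcongr
          exacts [hae x, hu.1 x]
      _ ≤ _ := by linarith
  · rw [norm_mul]
    calc ‖d x‖ * ‖v x‖ ≤ (2 * M) * (1 / 2) := by
          gcongr
          exacts [hde x, hv.1 x]
      _ ≤ _ := by linarith

/-- The Green's function exists, and its diagonal values are rational in the Riccati solutions. -/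
lemma greenKernel_values (hk : I * κ ^ 2 = k) (hk0 : k ≠ 0)
    (hqc : Continuous q) (hqb : ∃ B, ∀ x, ‖q x‖ ≤ B) (hqi : Integrable q)
    (hu : IsRiccati (2 * k) (fun x => κ * negConj q x) (fun x => κ * q x) u)
    (hv : IsRiccati (-2 * k) (fun x => κ * q x) (fun x => κ * negConj q x) v) :
    (∃ G, IsGreenKernel κ q G) ∧ ∀ x,
      gam κ q x = (1 + u x * v x) / (1 - u x * v x) - 1 ∧
      g12 κ q x = -v x / (1 - u x * v x) ∧
      g21 κ q x = u x / (1 - u x * v x) := by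
  obtain ⟨a, b, c, d, h, hbc⟩ := exists_isFrame hqc hqb hqi hu hv
  refine ⟨⟨_, h.isGreenKernel hk hk0⟩, fun x => ?_⟩
  obtain ⟨h1, h2, h3⟩ := h.diagonal_values hk hk0 x
  obtain ⟨hb, hc⟩ := hbc x
  have hne := (one_sub_mul_ne_zero hu hv x).2
  have hdet := h.det_eq_one x
  rw [hb, hc] at hdet
  have had : a x * d x = (1 - u x * v x)⁻¹ := by
    rw [← one_div, eq_div_iff hne]
    linear_combination hdet
  rw [h1, h2, h3, hb, hc]
  refine ⟨?_, ?_, ?_⟩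
  · linear_combination (1 + u x * v x) * had
  · linear_combination (-v x) * had
  · linear_combination (u x) * had

end IsRiccati

/-! ### Schwartz solutions and conservation of mass -/

open SchwartzMap

section Schwartz

lemma hasDerivAt_deriv (f : 𝓢(ℝ, ℂ)) (x : ℝ) : HasDerivAt (deriv f) (deriv (deriv f) x) x :=
  (derivCLM ℝ ℂ f).hasDerivAt x

lemma hasDerivAt_negConj {f : ℝ → ℂ} {f' : ℂ} {x : ℝ} (hf : HasDerivAt f f' x) :
    HasDerivAt (negConj f) (-conj f') x := by
  have := hf.star.neg
  exact this

lemma deriv_negConj (f : 𝓢(ℝ, ℂ)) (x : ℝ) : deriv (negConj f) x = -conj (deriv f x) :=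
  (hasDerivAt_negConj (f.hasDerivAt x)).deriv

lemma hasDerivAt_deriv_negConj (f : 𝓢(ℝ, ℂ)) (x : ℝ) :
    HasDerivAt (deriv (negConj f)) (-conj (deriv (deriv f) x)) x := by
  have : deriv (negConj f) = negConj (deriv f) := funext fun y => deriv_negConj f y
  rw [this]
  exact hasDerivAt_negConj (hasDerivAt_deriv f x)

/-- The time derivative `i q'' - (|q|² q)'` of a solution, as a bounded continuous function. -/
noncomputable def evolution (f : 𝓢(ℝ, ℂ)) : ℝ →ᵇ ℂ :=
  I • toBoundedContinuousFunctionCLM ℝ ℝ ℂ (derivCLM ℝ ℂ (derivCLM ℝ ℂ f)) -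
    (2 * (toBoundedContinuousFunctionCLM ℝ ℝ ℂ f *
        toBoundedContinuousFunctionCLM ℝ ℝ ℂ (derivCLM ℝ ℂ f) *
        star (toBoundedContinuousFunctionCLM ℝ ℝ ℂ f)) +
      toBoundedContinuousFunctionCLM ℝ ℝ ℂ f * toBoundedContinuousFunctionCLM ℝ ℝ ℂ f *
        star (toBoundedContinuousFunctionCLM ℝ ℝ ℂ (derivCLM ℝ ℂ f)))

lemma evolution_apply (f : 𝓢(ℝ, ℂ)) (x : ℝ) : evolution f x = I * deriv (deriv f) x -
    (2 * (f x * deriv f x * conj (f x)) + f x * f x * conj (deriv f x)) := by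
  have h : ((2 : ℝ →ᵇ ℂ) : ℝ → ℂ) x = 2 := rfl
  simp only [evolution, BoundedContinuousFunction.coe_sub, BoundedContinuousFunction.coe_add,
    BoundedContinuousFunction.coe_mul, BoundedContinuousFunction.coe_smul, Pi.sub_apply,
    Pi.add_apply, Pi.mul_apply, BoundedContinuousFunction.coe_star, Pi.star_apply, smul_eq_mul, h]
  rfl

lemma continuous_evolution : Continuous evolution := by
  unfold evolution
  fun_prop

lemma hasDerivAt_sq_norm_mul (f : 𝓢(ℝ, ℂ)) (x : ℝ) :
    HasDerivAt (fun y => ((‖f y‖ ^ 2 : ℝ) : ℂ) * f y)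
      (2 * (f x * deriv f x * conj (f x)) + f x * f x * conj (deriv f x)) x := by
  have h : (fun y => ((‖f y‖ ^ 2 : ℝ) : ℂ) * f y) = fun y => f y * conj (f y) * f y := by
    funext y
    rw [Complex.mul_conj']
    push_cast
    rfl
  rw [h]
  have h1 := f.hasDerivAt x
  have h2 : HasDerivAt (fun y => conj (f y)) (conj (deriv f x)) x := h1.star
  convert! (h1.mul h2).mul h1 using 1
  simp only [Pi.mul_apply]
  ring

variable {J : Set ℝ} {q : ℝ → 𝓢(ℝ, ℂ)} {t : ℝ}

lemma IsSchwartzSolution.hasDerivAt (h : IsSchwartzSolution J q) (ht : t ∈ J) (x : ℝ) :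
    HasDerivAt (fun τ => q τ x) (evolution (q t) x) t := by
  obtain ⟨hd, he⟩ := h.2 t ht x
  convert! hd.hasDerivAt using 1
  rw [(hasDerivAt_sq_norm_mul (q t) x).deriv, iteratedDeriv_succ, iteratedDeriv_one] at he
  rw [evolution_apply]
  linear_combination I * he - (deriv (fun τ => q τ x) t + (2 * (q t x * deriv (q t) x *
    conj (q t x)) + q t x * q t x * conj (deriv (q t) x))) * I_sq

/-- Pointwise differentiability with derivatives depending continuously on the parameter in the
supremum norm is differentiability in the supremum norm. -/
lemma hasDerivAt_of_pointwise {f f' : ℝ → ℝ →ᵇ ℂ} (hc : ContinuousAt f' t)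
    (hd : ∀ᶠ τ in 𝓝 t, ∀ x, HasDerivAt (fun τ => f τ x) (f' τ x) τ) : HasDerivAt f (f' t) t := by
  rw [hasDerivAt_iff_isLittleO, Asymptotics.isLittleO_iff]
  intro ε hε
  have hc' : ∀ᶠ τ in 𝓝 t, ‖f' τ - f' t‖ < ε := by
    have := (tendsto_iff_norm_sub_tendsto_zero.1 hc)
    exact this.eventually_lt_const hε
  obtain ⟨δ, hδ, hball⟩ := Metric.eventually_nhds_iff_ball.1 (hc'.and hd)
  filter_upwards [Metric.ball_mem_nhds t hδ] with τ hτ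
  rw [BoundedContinuousFunction.norm_le (by positivity)]
  intro x
  have := (convex_ball t δ).norm_image_sub_le_of_norm_hasDerivWithin_le (𝕜 := ℝ) (C := ε)
    (f := fun s => f s x - (s - t) • f' t x) (f' := fun s => f' s x - f' t x)
    (fun s hs => by
      have h1 := ((hball s hs).2 x).sub (((hasDerivAt_id s).sub_const t).smul_const (f' t x))
      convert! h1.hasDerivWithinAt using 1
      simp)
    (fun s hs => ((f' s - f' t).norm_coe_le_norm x).trans (hball s hs).1.le)
    (Metric.mem_ball_self hδ) hτ
  refine le_trans (le_of_eq ?_) this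
  simp only [BoundedContinuousFunction.coe_sub, BoundedContinuousFunction.coe_smul, Pi.sub_apply]
  congr 1
  simp
  ring

/-- The parameter lemma for Riccati equations needs coefficients differentiable in the supremum
norm; this comes from continuity of the curve in the Schwartz topology. -/
lemma IsSchwartzSolution.hasDerivAt_bcf (h : IsSchwartzSolution J q) (hJ : IsOpen J)
    (ht : t ∈ J) :
    HasDerivAt (fun τ => toBoundedContinuousFunctionCLM ℝ ℝ ℂ (q τ)) (evolution (q t)) t :=
  hasDerivAt_of_pointwise (f' := fun τ => evolution (q τ))
    (continuous_evolution.continuousAt.comp (h.1.continuousAt (hJ.mem_nhds ht)))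
    (Filter.eventually_of_mem (hJ.mem_nhds ht) fun _ hτ x => h.hasDerivAt hτ x)

lemma norm_le_seminorm_mul (f : 𝓢(ℝ, ℂ)) (x : ℝ) :
    ‖f x‖ ≤ (SchwartzMap.seminorm ℝ 0 0 f + SchwartzMap.seminorm ℝ 2 0 f) * (1 + x ^ 2)⁻¹ := by
  have h0 := SchwartzMap.norm_pow_mul_le_seminorm ℝ f 0 x
  have h2 := SchwartzMap.norm_pow_mul_le_seminorm ℝ f 2 x
  rw [← div_eq_mul_inv, le_div_iff₀ (by positivity)]
  rw [Real.norm_eq_abs, sq_abs] at h2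
  simp only [pow_zero, one_mul] at h0
  linarith

lemma integrable_mul_bcf (f : 𝓢(ℝ, ℂ)) (g : ℝ →ᵇ ℂ) : Integrable fun x => g x * f x :=
  f.integrable.bdd_mul g.continuous.aestronglyMeasurable (ae_of_all _ fun x => g.norm_coe_le_norm x)

lemma integrable_mul_conj (f g : 𝓢(ℝ, ℂ)) : Integrable fun x => f x * conj (g x) := by
  have := integrable_mul_bcf f (star (toBoundedContinuousFunctionCLM ℝ ℝ ℂ g))
  refine this.congr (ae_of_all _ fun x => ?_)
  simp only [mul_comm]
  rfl

/-- The `L²` norm of a solution does not vary to first order. -/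
lemma IsSchwartzSolution.hasDerivAt_mass (h : IsSchwartzSolution J q) (hJ : IsOpen J)
    (ht : t ∈ J) : HasDerivAt (fun τ => ∫ x, q τ x * conj (q τ x)) 0 t := by
  have hcont := h.1.continuousAt (hJ.mem_nhds ht)
  have hsem : Continuous fun f : 𝓢(ℝ, ℂ) =>
      SchwartzMap.seminorm ℝ 0 0 f + SchwartzMap.seminorm ℝ 2 0 f :=
    ((schwartz_withSeminorms ℝ ℝ ℂ).continuous_seminorm (0, 0)).add
      ((schwartz_withSeminorms ℝ ℝ ℂ).continuous_seminorm (2, 0))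
  -- Continuity of the seminorms gives `‖q τ x‖ ≤ C / (1 + x²)` uniformly for `τ` near `t`, an
  -- integrable majorant for differentiating under the integral.
  obtain ⟨C, hC⟩ : ∃ C, C = SchwartzMap.seminorm ℝ 0 0 (q t) +
    SchwartzMap.seminorm ℝ 2 0 (q t) + 1 := ⟨_, rfl⟩
  obtain ⟨D, hD⟩ : ∃ D, D = ‖evolution (q t)‖ + 1 := ⟨_, rfl⟩
  have hCe : ∀ᶠ τ in 𝓝 t, SchwartzMap.seminorm ℝ 0 0 (q τ) +
      SchwartzMap.seminorm ℝ 2 0 (q τ) < C :=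
    (hsem.continuousAt.comp hcont).eventually_lt_const (by rw [hC]; exact lt_add_one _)
  have hDe : ∀ᶠ τ in 𝓝 t, ‖evolution (q τ)‖ < D :=
    (continuous_evolution.norm.continuousAt.comp hcont).eventually_lt_const
      (by rw [hD]; exact lt_add_one _)
  have key := hasDerivAt_integral_of_dominated_loc_of_deriv_le (μ := volume) (x₀ := t)
    (F := fun τ x => q τ x * conj (q τ x))
    (F' := fun τ x => evolution (q τ) x * conj (q τ x) + q τ x * conj (evolution (q τ) x))
    (bound := fun x => 2 * D * (C * (1 + x ^ 2)⁻¹))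
    ((hCe.and hDe).and (hJ.mem_nhds ht))
    (Eventually.of_forall fun τ => (integrable_mul_conj (q τ) (q τ)).aestronglyMeasurable)
    (integrable_mul_conj (q t) (q t))
    (Continuous.aestronglyMeasurable (by
      have := (q t).continuous
      have := (evolution (q t)).continuous
      fun_prop))
    (ae_of_all _ fun x τ hτ => by
      have h1 := (norm_le_seminorm_mul (q τ) x).trans
        (mul_le_mul_of_nonneg_right hτ.1.1.le (by positivity))
      have h2 := ((evolution (q τ)).norm_coe_le_norm x).trans hτ.1.2.le
      have h3 : 0 ≤ D := (norm_nonneg _).trans h2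
      have h4 := (norm_nonneg _).trans h1
      refine (norm_add_le _ _).trans ?_
      simp only [norm_mul, RCLike.norm_conj]
      calc _ ≤ D * (C * (1 + x ^ 2)⁻¹) + (C * (1 + x ^ 2)⁻¹) * D := by gcongr
        _ = _ := by ring)
    ((integrable_inv_one_add_sq.const_mul C).const_mul _)
    (ae_of_all _ fun x τ hτ => by
      have h1 := h.hasDerivAt hτ.2 x
      exact h1.mul h1.star)
  convert! key.2 using 1
  symm
  set f := q t
  have hb : ∀ f g : 𝓢(ℝ, ℂ), Integrable fun x => f x * conj (g x) := integrable_mul_conj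
  -- The time derivative of `|q|²` is the `x`-derivative of `i(q̄ q' - q q̄') - (3/2)|q|⁴`, an
  -- integrable function.
  refine integral_eq_zero_of_hasDerivAt_of_integrable
    (f := fun x => I * (conj (f x) * deriv f x) - I * (f x * conj (deriv f x)) -
      3 / 2 * (f x * conj (f x)) ^ 2) (fun x => ?_) key.1 ?_
  · have h1 := f.hasDerivAt x
    have h2 := hasDerivAt_deriv f x
    have h1' : HasDerivAt (fun y => conj (f y)) (conj (deriv f x)) x := h1.star
    have h2' : HasDerivAt (fun y => conj (deriv f y)) (conj (deriv (deriv f) x)) x := h2.star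
    convert! (((h1'.mul h2).const_mul I).sub ((h1.mul h2').const_mul I)).sub
      (((h1.mul h1').pow 2).const_mul (3 / 2)) using 1
    simp only [evolution_apply, map_sub, map_add, map_mul, Complex.conj_conj, Complex.conj_I,
      map_ofNat, Pi.mul_apply]
    push_cast
    ring
  · refine Integrable.sub (Integrable.sub ?_ ?_) ?_
    · refine ((hb (derivCLM ℝ ℂ f) f).const_mul I).congr (ae_of_all _ fun x => ?_)
      simp only [derivCLM_apply]
      ring
    · exact (hb f (derivCLM ℝ ℂ f)).const_mul I
    · let F := toBoundedContinuousFunctionCLM ℝ ℝ ℂ f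
      refine ((integrable_mul_bcf f (star F * F * star F)).const_mul (3 / 2)).congr
        (ae_of_all _ fun x => ?_)
      have : (star F * F * star F) x = conj (f x) * f x * conj (f x) := rfl
      simp only [this]
      ring

/-- Conservation of mass. -/
lemma IsSchwartzSolution.integral_sq_norm_eq (h : IsSchwartzSolution J q) (hJ : IsOpen J)
    (hJc : J.OrdConnected) (h0 : 0 ∈ J) (ht : t ∈ J) :
    ∫ x, ‖q t x‖ ^ 2 = ∫ x, ‖q 0 x‖ ^ 2 := by
  have hd := fun τ (hτ : τ ∈ J) => h.hasDerivAt_mass hJ hτ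
  have := hJ.is_const_of_deriv_eq_zero hJc.isPreconnected
    (fun τ hτ => (hd τ hτ).differentiableAt.differentiableWithinAt)
    (fun τ hτ => (hd τ hτ).deriv) ht h0
  have hconv : ∀ τ, ∫ x, q τ x * conj (q τ x) = ((∫ x, ‖q τ x‖ ^ 2 : ℝ) : ℂ) := fun τ => by
    rw [← integral_complex_ofReal]
    congr 1
    funext x
    rw [Complex.mul_conj']
    push_cast
    rfl
  rw [hconv, hconv] at this
  exact_mod_cast this

end Schwartz

/-! ### The time part of the Lax pair -/

/-- Diagonal coefficient of the time part of the Lax pair. -/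
noncomputable def laxA (κ : ℂ) (f : ℝ → ℂ) (x : ℝ) : ℂ :=
  2 * I * κ ^ 4 + I * κ ^ 2 * f x * negConj f x

/-- Upper right coefficient of the time part of the Lax pair. -/
noncomputable def laxB (κ : ℂ) (f : ℝ → ℂ) (x : ℝ) : ℂ :=
  2 * κ ^ 3 * f x + I * κ * deriv f x + κ * f x ^ 2 * negConj f x

/-- Lower left coefficient of the time part of the Lax pair. -/
noncomputable def laxC (κ : ℂ) (f : ℝ → ℂ) (x : ℝ) : ℂ :=
  2 * κ ^ 3 * negConj f x - I * κ * deriv (negConj f) x + κ * f x * negConj f x ^ 2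

/-- Supplies the boundedness of the predicted time derivatives of `u` and `v`. -/
lemma exists_lax_bcf (κ : ℂ) (f : 𝓢(ℝ, ℂ)) : ∃ A B C : ℝ →ᵇ ℂ,
    (∀ x, A x = laxA κ f x) ∧ (∀ x, B x = laxB κ f x) ∧ ∀ x, C x = laxC κ f x := by
  let F := toBoundedContinuousFunctionCLM ℝ ℝ ℂ f
  let F' := toBoundedContinuousFunctionCLM ℝ ℝ ℂ (derivCLM ℝ ℂ f)
  refine ⟨(2 * I * κ ^ 4) • 1 + (I * κ ^ 2) • (F * -star F),
    (2 * κ ^ 3) • F + (I * κ) • F' + κ • (F * F * -star F),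
    (2 * κ ^ 3) • (-star F) - (I * κ) • (-star F') + κ • (F * (-star F * -star F)),
    fun x => ?_, fun x => ?_, fun x => ?_⟩
  · have : ((2 * I * κ ^ 4) • (1 : ℝ →ᵇ ℂ) + (I * κ ^ 2) • (F * -star F)) x =
      (2 * I * κ ^ 4) * 1 + (I * κ ^ 2) * (f x * negConj f x) := rfl
    rw [this, laxA]; ring
  · have : ((2 * κ ^ 3) • F + (I * κ) • F' + κ • (F * F * -star F)) x =
      (2 * κ ^ 3) * f x + (I * κ) * deriv f x + κ * (f x * f x * negConj f x) := rfl
    rw [this, laxB]; ring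
  · have : ((2 * κ ^ 3) • (-star F) - (I * κ) • (-star F') + κ • (F * (-star F * -star F))) x =
      (2 * κ ^ 3) * negConj f x - (I * κ) * (-conj (deriv f x)) +
        κ * (f x * (negConj f x * negConj f x)) := rfl
    rw [this, laxC, deriv_negConj]; ring

lemma hasDerivAt_lax (κ : ℂ) (f : 𝓢(ℝ, ℂ)) (x : ℝ) :
    HasDerivAt (laxA κ f) (I * κ ^ 2 * (deriv f x * negConj f x + f x * deriv (negConj f) x)) x ∧
    HasDerivAt (laxB κ f) (2 * κ ^ 3 * deriv f x + I * κ * deriv (deriv f) x +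
      κ * (2 * f x * deriv f x * negConj f x + f x ^ 2 * deriv (negConj f) x)) x ∧
    HasDerivAt (laxC κ f) (2 * κ ^ 3 * deriv (negConj f) x - I * κ * deriv (deriv (negConj f)) x +
      κ * (deriv f x * negConj f x ^ 2 + 2 * f x * negConj f x * deriv (negConj f) x)) x := by
  have h0 := f.hasDerivAt x
  have h1 := hasDerivAt_deriv f x
  have h2 : HasDerivAt (negConj f) (deriv (negConj f) x) x :=
    (hasDerivAt_negConj h0).differentiableAt.hasDerivAt
  have h3 : HasDerivAt (deriv (negConj f)) (deriv (deriv (negConj f)) x) x :=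
    (hasDerivAt_deriv_negConj f x).differentiableAt.hasDerivAt
  refine ⟨?_, ?_, ?_⟩
  · convert! ((h0.const_mul (I * κ ^ 2)).mul h2).const_add (2 * I * κ ^ 4) using 1
    ring
  · convert! ((h0.const_mul (2 * κ ^ 3)).add (h1.const_mul (I * κ))).add
      (((h0.pow 2).const_mul κ).mul h2) using 1
    simp only [Pi.pow_apply]
    push_cast
    ring
  · convert! ((h2.const_mul (2 * κ ^ 3)).sub (h3.const_mul (I * κ))).add
      ((h0.const_mul κ).mul (h2.pow 2)) using 1
    push_cast
    simp only [Pi.pow_apply]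
    ring

/-- Here and in the next lemma conjugates are written through `r`, so that the compatibility
identities become polynomial identities in `q`, `r` and their derivatives. -/
lemma evolution_eq (f : 𝓢(ℝ, ℂ)) (x : ℝ) : evolution f x = I * deriv (deriv f) x +
    (2 * f x * deriv f x * negConj f x + f x ^ 2 * deriv (negConj f) x) := by
  rw [evolution_apply, deriv_negConj, negConj]
  ring

lemma negConj_evolution_eq (f : 𝓢(ℝ, ℂ)) (x : ℝ) :
    negConj (evolution f) x = -I * deriv (deriv (negConj f)) x +
      (deriv f x * negConj f x ^ 2 + 2 * f x * negConj f x * deriv (negConj f) x) := by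
  rw [(hasDerivAt_deriv_negConj f x).deriv, deriv_negConj, negConj, negConj, evolution_apply]
  simp only [map_sub, map_add, map_mul, Complex.conj_conj, Complex.conj_I, map_ofNat]
  ring

/-! ### Time evolution of the Riccati solutions -/

section Riccati

variable {κ : ℂ} {k : ℝ} {J : Set ℝ} {q : ℝ → 𝓢(ℝ, ℂ)} {t : ℝ}

lemma integrable_sq_norm (f : 𝓢(ℝ, ℂ)) : Integrable fun x => ‖f x‖ ^ 2 :=
  (memLp_two_iff_integrable_sq_norm f.continuous.aestronglyMeasurable).1 (f.memLp 2 volume)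

/-- Since `‖κ‖² = |k|`, mass at most `1/4` gives `|k| / 4 = |2k| / 8`, exactly the smallness
required for the exponents `±2k`. -/
lemma integral_weight_le (hk : I * κ ^ 2 = k) {f : 𝓢(ℝ, ℂ)} (hf : ∫ x, ‖f x‖ ^ 2 ≤ 1 / 4) :
    Integrable (fun x => (‖κ‖ * ‖f x‖) ^ 2) ∧ ∫ x, (‖κ‖ * ‖f x‖) ^ 2 ≤ |2 * k| / 8 := by
  have hn : ‖κ‖ ^ 2 = |k| := by
    have := congrArg norm hk
    simpa using this
  simp only [mul_pow, hn]
  refine ⟨(integrable_sq_norm f).const_mul _, ?_⟩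
  rw [integral_const_mul, abs_mul, abs_two]
  have := abs_nonneg k
  nlinarith

lemma exists_isRiccati_pair (hk : I * κ ^ 2 = k) (hk0 : k ≠ 0) {f : 𝓢(ℝ, ℂ)}
    (hf : ∫ x, ‖f x‖ ^ 2 ≤ 1 / 4) : ∃ u v : ℝ → ℂ,
    IsRiccati (2 * k) (fun x => κ * negConj f x) (fun x => κ * f x) u ∧
    IsRiccati (-2 * k) (fun x => κ * f x) (fun x => κ * negConj f x) v := by
  obtain ⟨h1, h2⟩ := integral_weight_le hk hf
  have hφ : Continuous fun x => ‖κ‖ * ‖f x‖ := continuous_const.mul f.continuous.norm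
  let F := toBoundedContinuousFunctionCLM ℝ ℝ ℂ f
  have hF : ∀ x, ‖(κ • F) x‖ ≤ ‖κ‖ * ‖f x‖ := fun x => (norm_mul _ _).le
  have hR : ∀ x, ‖(κ • -star F) x‖ ≤ ‖κ‖ * ‖f x‖ := fun x => by
    have : (κ • -star F) x = κ * negConj f x := rfl
    rw [this, norm_mul, norm_negConj]
  obtain ⟨u, hu⟩ := exists_isRiccati (l := 2 * k) (by positivity) (κ • -star F) (κ • F) hφ h1 h2
    hR hF
  obtain ⟨v, hv⟩ := exists_isRiccati (l := -2 * k) (mul_ne_zero (by norm_num) hk0) (κ • F)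
    (κ • -star F) hφ h1 (by rwa [neg_mul, abs_neg]) hF hR
  exact ⟨u, v, hu, hv⟩

lemma exists_bcf_eq {l : ℝ} {p s u : ℝ → ℂ} (hu : IsRiccati l p s u) :
    ∃ w : ℝ →ᵇ ℂ, ∀ x, w x = u x :=
  ⟨ofNormedAddCommGroup u hu.continuous _ hu.1, fun _ => rfl⟩

/-- Time evolution of the Riccati solution built from the first column of the frame. -/
lemma hasDerivAt_time_left (hk : I * κ ^ 2 = k) (hk0 : k ≠ 0) (hJ : IsOpen J)
    (hq : IsSchwartzSolution J q) (ht : t ∈ J) (hM : ∫ x, ‖q t x‖ ^ 2 ≤ 1 / 4) {u : ℝ → ℝ → ℂ}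
    (hu : ∀ τ ∈ J, IsRiccati (2 * k) (fun x => κ * negConj (q τ) x) (fun x => κ * q τ x) (u τ))
    (x : ℝ) : HasDerivAt (fun τ => u τ x)
      (laxC κ (q t) x + 2 * laxA κ (q t) x * u t x - laxB κ (q t) x * u t x ^ 2) t := by
  obtain ⟨h1, h2⟩ := integral_weight_le hk hM
  have hφ : Continuous fun x => ‖κ‖ * ‖q t x‖ := continuous_const.mul (q t).continuous.norm
  have hS := (hq.hasDerivAt_bcf hJ ht).const_smul κ
  have hP := ((hq.hasDerivAt_bcf hJ ht).star.neg).const_smul κ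
  obtain ⟨A, B, C, hA, hB, hC⟩ := exists_lax_bcf κ (q t)
  obtain ⟨w, hw⟩ := exists_bcf_eq (hu t ht)
  have hb : ∀ x, ‖laxC κ (q t) x + 2 * laxA κ (q t) x * u t x - laxB κ (q t) x * u t x ^ 2‖ ≤
      ‖C + (2 : ℂ) • (A * w) - B * (w * w)‖ := fun x => by
    have := (C + (2 : ℂ) • (A * w) - B * (w * w)).norm_coe_le_norm x
    have e : (C + (2 : ℂ) • (A * w) - B * (w * w)) x =
      C x + 2 * (A x * w x) - B x * (w x * w x) := rfl
    rw [e, hA, hB, hC, hw] at this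
    refine le_trans (le_of_eq (congrArg norm ?_)) this
    ring
  -- What remains is that the prediction `C + 2A u - B u²` solves the linearized Riccati equation.
  -- This is the zero curvature relation of the Lax pair, checked using the evolution equations of
  -- `q` and `r`.
  refine hasDerivAt_of_isRiccati (l := 2 * k) (by positivity) hP hS hφ h1 h2
    (fun x => (norm_mul _ _).le) (Filter.eventually_of_mem (hJ.mem_nhds ht) hu) hb (fun y => ?_) x
  obtain ⟨dA, dB, dC⟩ := hasDerivAt_lax κ (q t) y
  have du := (hu t ht).2 y
  convert! (dC.add ((dA.const_mul 2).mul du)).sub (dB.mul (du.pow 2)) using 1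
  have e1 : (κ • -star (evolution (q t))) y = κ * negConj (evolution (q t)) y := rfl
  have e2 : (κ • evolution (q t)) y = κ * evolution (q t) y := rfl
  have e3 : (κ • toBoundedContinuousFunctionCLM ℝ ℝ ℂ (q t)) y = κ * q t y := rfl
  simp only [Pi.smul_apply, Pi.pow_apply] at *
  rw [e1, e2, e3, evolution_eq, negConj_evolution_eq]
  push_cast
  rw [← hk, laxA, laxB, laxC]
  linear_combination
    (-(2 * κ ^ 3 * (deriv (negConj (q t)) y - deriv (q t) y * u t y ^ 2))) * I_sq

/-- Time evolution of the Riccati solution built from the second column of the frame. -/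
lemma hasDerivAt_time_right (hk : I * κ ^ 2 = k) (hk0 : k ≠ 0) (hJ : IsOpen J)
    (hq : IsSchwartzSolution J q) (ht : t ∈ J) (hM : ∫ x, ‖q t x‖ ^ 2 ≤ 1 / 4) {v : ℝ → ℝ → ℂ}
    (hv : ∀ τ ∈ J, IsRiccati (-2 * k) (fun x => κ * q τ x) (fun x => κ * negConj (q τ) x) (v τ))
    (x : ℝ) : HasDerivAt (fun τ => v τ x)
      (laxB κ (q t) x - 2 * laxA κ (q t) x * v t x - laxC κ (q t) x * v t x ^ 2) t := by
  obtain ⟨h1, h2⟩ := integral_weight_le hk hM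
  have hφ : Continuous fun x => ‖κ‖ * ‖q t x‖ := continuous_const.mul (q t).continuous.norm
  have hP := (hq.hasDerivAt_bcf hJ ht).const_smul κ
  have hS := ((hq.hasDerivAt_bcf hJ ht).star.neg).const_smul κ
  obtain ⟨A, B, C, hA, hB, hC⟩ := exists_lax_bcf κ (q t)
  obtain ⟨w, hw⟩ := exists_bcf_eq (hv t ht)
  have hb : ∀ x, ‖laxB κ (q t) x - 2 * laxA κ (q t) x * v t x - laxC κ (q t) x * v t x ^ 2‖ ≤
      ‖B - (2 : ℂ) • (A * w) - C * (w * w)‖ := fun x => by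
    have := (B - (2 : ℂ) • (A * w) - C * (w * w)).norm_coe_le_norm x
    have e : (B - (2 : ℂ) • (A * w) - C * (w * w)) x =
      B x - 2 * (A x * w x) - C x * (w x * w x) := rfl
    rw [e, hA, hB, hC, hw] at this
    refine le_trans (le_of_eq (congrArg norm ?_)) this
    ring
  -- The same compatibility argument, with `k ↦ -k`, `A ↦ -A`, and the roles of `q, r` and `B, C`
  -- exchanged.
  refine hasDerivAt_of_isRiccati (l := -2 * k) (mul_ne_zero (by norm_num) hk0) hP hS hφ h1
    (by rwa [neg_mul, abs_neg])
    (fun x => ?_) (Filter.eventually_of_mem (hJ.mem_nhds ht) hv) hb (fun y => ?_) x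
  · have : (κ • -star (toBoundedContinuousFunctionCLM ℝ ℝ ℂ (q t))) x = κ * negConj (q t) x := rfl
    refine (congrArg norm this).trans_le ?_
    rw [norm_mul, norm_negConj]
  obtain ⟨dA, dB, dC⟩ := hasDerivAt_lax κ (q t) y
  have dv := (hv t ht).2 y
  convert! (dB.sub ((dA.const_mul 2).mul dv)).sub (dC.mul (dv.pow 2)) using 1
  have e1 : (κ • -star (evolution (q t))) y = κ * negConj (evolution (q t)) y := rfl
  have e2 : (κ • evolution (q t)) y = κ * evolution (q t) y := rfl
  have e3 : (κ • -star (toBoundedContinuousFunctionCLM ℝ ℝ ℂ (q t))) y =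
    κ * negConj (q t) y := rfl
  simp only [Pi.smul_apply, Pi.pow_apply, Pi.neg_apply] at *
  rw [e1, e2, e3, evolution_eq, negConj_evolution_eq]
  push_cast
  rw [← hk, laxA, laxB, laxC]
  linear_combination
    (-(2 * κ ^ 3 * (deriv (q t) y - deriv (negConj (q t)) y * v t y ^ 2))) * I_sq

end Riccati

/-! ### Density and flux in terms of the Riccati solutions -/

section Evolution

variable {κ : ℂ} {k : ℝ} {f : 𝓢(ℝ, ℂ)} {u v : ℝ → ℂ}

lemma exists_bound (f : 𝓢(ℝ, ℂ)) : ∃ B, ∀ x, ‖f x‖ ≤ B :=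
  ⟨_, (toBoundedContinuousFunctionCLM ℝ ℝ ℂ f).norm_coe_le_norm⟩

/-- Because `2 + γ = 2 / (1 - uv)`, the denominators cancel and the density is linear in `u` and
`v`. -/
lemma density_eq (hg : ∀ x,
      gam κ f x = (1 + u x * v x) / (1 - u x * v x) - 1 ∧
      g12 κ f x = -v x / (1 - u x * v x) ∧ g21 κ f x = u x / (1 - u x * v x))
    (hne : ∀ x, 1 - u x * v x ≠ 0) (x : ℝ) :
    density κ f x = -κ / 2 * (f x * u x - negConj f x * v x) := by
  obtain ⟨h1, h2, h3⟩ := hg x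
  have := hne x
  have h4 : 2 + ((1 + u x * v x) / (1 - u x * v x) - 1) = 2 / (1 - u x * v x) := by
    field_simp
    ring
  rw [density, h1, h2, h3, h4]
  field_simp
  ring

lemma flux_eq (hg : ∀ x,
      gam κ f x = (1 + u x * v x) / (1 - u x * v x) - 1 ∧
      g12 κ f x = -v x / (1 - u x * v x) ∧ g21 κ f x = u x / (1 - u x * v x))
    (hne : ∀ x, 1 - u x * v x ≠ 0) (x : ℝ) :
    flux κ f x = I * κ / 2 * (deriv f x * u x + deriv (negConj f) x * v x)
      - I * κ ^ 2 * f x * negConj f x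
      - 2 * κ ^ 2 * (-κ / 2 * (f x * u x - negConj f x * v x))
      - f x * negConj f x * (-κ / 2 * (f x * u x - negConj f x * v x)) := by
  rw [flux, density_eq hg hne]
  obtain ⟨h1, h2, h3⟩ := hg x
  have := hne x
  have h4 : 2 + ((1 + u x * v x) / (1 - u x * v x) - 1) = 2 / (1 - u x * v x) := by
    field_simp
    ring
  rw [h1, h2, h3, h4]
  field_simp
  ring

/-- The spatial derivatives of `γ` and of the flux. -/
lemma hasDerivAt_gam_flux (hk : I * κ ^ 2 = k)
    (hu : IsRiccati (2 * k) (fun x => κ * negConj f x) (fun x => κ * f x) u)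
    (hv : IsRiccati (-2 * k) (fun x => κ * f x) (fun x => κ * negConj f x) v)
    (hg : ∀ x, gam κ f x = (1 + u x * v x) / (1 - u x * v x) - 1 ∧
      g12 κ f x = -v x / (1 - u x * v x) ∧ g21 κ f x = u x / (1 - u x * v x)) (x : ℝ) :
    HasDerivAt (gam κ f) (2 * κ * (f x * g21 κ f x - negConj f x * g12 κ f x)) x ∧
    HasDerivAt (flux κ f) (κ / 2 * (evolution f x * u x +
      f x * (laxC κ f x + 2 * laxA κ f x * u x - laxB κ f x * u x ^ 2)
      - negConj (evolution f) x * v x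
      - negConj f x * (laxB κ f x - 2 * laxA κ f x * v x - laxC κ f x * v x ^ 2))) x := by
  have hne : ∀ x, 1 - u x * v x ≠ 0 := fun x => (hu.one_sub_mul_ne_zero hv x).2
  have hn := hne x
  have du := hu.2 x
  have dv := hv.2 x
  have df := f.hasDerivAt x
  have df' := hasDerivAt_deriv f x
  have dr : HasDerivAt (negConj f) (deriv (negConj f) x) x :=
    (hasDerivAt_negConj df).differentiableAt.hasDerivAt
  have dr' : HasDerivAt (deriv (negConj f)) (deriv (deriv (negConj f)) x) x :=
    (hasDerivAt_deriv_negConj f x).differentiableAt.hasDerivAt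
  push_cast at du dv
  rw [← hk] at du dv
  constructor
  · have he : gam κ f = fun x => (1 + u x * v x) / (1 - u x * v x) - 1 :=
      funext fun x => (hg x).1
    rw [(hg x).2.1, (hg x).2.2, he]
    have duv := du.mul dv
    convert! ((duv.const_add 1).div (duv.const_sub 1) hn).sub_const 1 using 1
    simp only [Pi.mul_apply]
    field_simp
    ring
  -- The target is `-∂ₜρ` with the time derivatives of `q`, `r`, `u`, `v` inserted. The Riccati
  -- equations eliminate `u'` and `v'`, and the two sides agree up to a multiple of `I² + 1`.
  · rw [funext fun x => flux_eq hg hne x]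
    have dρ := ((df.mul du).sub (dr.mul dv)).const_mul (-κ / 2)
    convert! (((((df'.mul du).add (dr'.mul dv)).const_mul (I * κ / 2)).sub
      ((df.const_mul (I * κ ^ 2)).mul dr)).sub (dρ.const_mul (2 * κ ^ 2))).sub
      ((df.mul dr).mul dρ) using 1
    rw [evolution_eq, negConj_evolution_eq, laxA, laxB, laxC]
    simp only [Pi.mul_apply, Pi.sub_apply]
    linear_combination (-(κ ^ 3 * (deriv f x * u x - deriv (negConj f) x * v x))) * I_sq

end Evolution

/-! ### Time derivatives of the diagonal values -/

section Algebra

variable {U V : ℝ → ℂ} {A B C : ℂ} {t : ℝ}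

/-- Time derivatives of the rational expressions in the Riccati solutions. -/
lemma hasDerivAt_riccati_rational (hn : 1 - U t * V t ≠ 0)
    (hU : HasDerivAt U (C + 2 * A * U t - B * U t ^ 2) t)
    (hV : HasDerivAt V (B - 2 * A * V t - C * V t ^ 2) t) :
    HasDerivAt (fun τ => -V τ / (1 - U τ * V τ))
      (-2 * A * (-V t / (1 - U t * V t)) - B * ((1 + U t * V t) / (1 - U t * V t))) t ∧
    HasDerivAt (fun τ => U τ / (1 - U τ * V τ))
      (2 * A * (U t / (1 - U t * V t)) + C * ((1 + U t * V t) / (1 - U t * V t))) t ∧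
    HasDerivAt (fun τ => (1 + U τ * V τ) / (1 - U τ * V τ) - 1)
      (2 * (B * (U t / (1 - U t * V t)) - C * (-V t / (1 - U t * V t)))) t := by
  have hUV := hU.mul hV
  refine ⟨?_, ?_, ?_⟩
  · convert! hV.neg.div (hUV.const_sub 1) hn using 1
    simp only [Pi.mul_apply, Pi.neg_apply]
    rw [eq_div_iff (pow_ne_zero 2 hn)]
    field_simp
    ring
  · convert! hU.div (hUV.const_sub 1) hn using 1
    simp only [Pi.mul_apply]
    field_simp
    ring
  · convert! ((hUV.const_add 1).div (hUV.const_sub 1) hn).sub_const 1 using 1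
    simp only [Pi.mul_apply]
    field_simp
    ring

end Algebra

end DNLS

/-! ### Assembly of the theorem -/

open DNLS in
theorem theorem4 :
    ∃ δ : ℝ, 0 < δ ∧
      ∀ (κ : ℂ) (J : Set ℝ) (q : ℝ → SchwartzMap ℝ ℂ),
        (Complex.I * κ ^ 2).im = 0 → 1 ≤ |(Complex.I * κ ^ 2).re| →
        IsOpen J → J.OrdConnected → (0 : ℝ) ∈ J →
        DNLS.IsSchwartzSolution J q →
        (∫ x : ℝ, ‖q 0 x‖ ^ 2) ≤ δ →
        ∀ t ∈ J,
          (∃! G : ℝ → ℝ → Matrix (Fin 2) (Fin 2) ℂ, DNLS.IsGreenKernel κ (q t) G) ∧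
          ∀ x : ℝ,
            -- the equations for q and r
            HasDerivAt (fun τ : ℝ => q τ x)
              (Complex.I * iteratedDeriv 2 (q t) x
                + deriv (fun y : ℝ => q t y ^ 2 * DNLS.negConj (q t) y) x) t ∧
            HasDerivAt (fun τ : ℝ => DNLS.negConj (q τ) x)
              (-Complex.I * iteratedDeriv 2 (DNLS.negConj (q t)) x
                + deriv (fun y : ℝ => q t y * DNLS.negConj (q t) y ^ 2) x) t ∧
            -- the evolution of g12
            HasDerivAt (fun τ : ℝ => DNLS.g12 κ (q τ) x)
              (-2 * (2 * Complex.I * κ ^ 4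
                    + Complex.I * κ ^ 2 * q t x * DNLS.negConj (q t) x) * DNLS.g12 κ (q t) x
                - (2 * κ ^ 3 * q t x + Complex.I * κ * deriv (q t) x
                    + κ * q t x ^ 2 * DNLS.negConj (q t) x) * (DNLS.gam κ (q t) x + 1)) t ∧
            -- the evolution of g21
            HasDerivAt (fun τ : ℝ => DNLS.g21 κ (q τ) x)
              (2 * (2 * Complex.I * κ ^ 4
                    + Complex.I * κ ^ 2 * q t x * DNLS.negConj (q t) x) * DNLS.g21 κ (q t) x
                + (2 * κ ^ 3 * DNLS.negConj (q t) x - Complex.I * κ * deriv (DNLS.negConj (q t)) x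
                    + κ * q t x * DNLS.negConj (q t) x ^ 2) * (DNLS.gam κ (q t) x + 1)) t ∧
            -- the evolution of gamma
            DifferentiableAt ℝ (DNLS.gam κ (q t)) x ∧
            HasDerivAt (fun τ : ℝ => DNLS.gam κ (q τ) x)
              (2 * κ ^ 2 * deriv (DNLS.gam κ (q t)) x
                + 2 * Complex.I * κ * (deriv (q t) x * DNLS.g21 κ (q t) x
                    + deriv (DNLS.negConj (q t)) x * DNLS.g12 κ (q t) x)
                + q t x * DNLS.negConj (q t) x * deriv (DNLS.gam κ (q t)) x) t ∧
            -- the microscopic conservation law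
            2 + DNLS.gam κ (q t) x ≠ 0 ∧
            DifferentiableAt ℝ (fun τ : ℝ => DNLS.density κ (q τ) x) t ∧
            DifferentiableAt ℝ (DNLS.flux κ (q t)) x ∧
            deriv (fun τ : ℝ => DNLS.density κ (q τ) x) t + deriv (DNLS.flux κ (q t)) x = 0 := by
  -- The mass for which `‖κ q‖²` in `L²` is at most `|2k| / 8`, whatever `κ` is.
  refine ⟨1 / 4, by norm_num, ?_⟩
  intro κ J q him hre hJo hJc h0 hq hM t ht
  obtain ⟨k, hkre⟩ : ∃ k : ℝ, k = (Complex.I * κ ^ 2).re := ⟨_, rfl⟩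
  have hk : Complex.I * κ ^ 2 = k := Complex.ext (by simp [hkre]) (by simp [him])
  have hk0 : k ≠ 0 := by
    intro h
    rw [← hkre, h, abs_zero] at hre
    linarith
  have hMt : ∀ τ ∈ J, ∫ x, ‖q τ x‖ ^ 2 ≤ 1 / 4 := fun τ hτ =>
    (hq.integral_sq_norm_eq hJo hJc h0 hτ).trans_le hM
  -- The solutions are chosen independently at each time. No regularity in `τ` is built in; it comes
  -- from the stability of bounded Riccati solutions.
  choose! u v hu hv using fun τ (hτ : τ ∈ J) => exists_isRiccati_pair hk hk0 (hMt τ hτ)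
  have hval := fun τ (hτ : τ ∈ J) => IsRiccati.greenKernel_values hk hk0 (q τ).continuous
    (exists_bound (q τ)) (q τ).integrable (hu τ hτ) (hv τ hτ)
  have hJt : J ∈ nhds t := hJo.mem_nhds ht
  obtain ⟨⟨G, hG⟩, hg⟩ := hval t ht
  refine ⟨⟨G, hG, fun G' hG' => hG'.unique hG⟩, fun x => ?_⟩
  obtain ⟨e1, e2, e3⟩ := hg x
  have hne : ∀ τ ∈ J, ∀ x, 1 - u τ x * v τ x ≠ 0 := fun τ hτ x =>
    ((hu τ hτ).one_sub_mul_ne_zero (hv τ hτ) x).2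
  have hn := hne t ht x
  have dq := hq.hasDerivAt ht x
  have dr := hasDerivAt_negConj dq
  have dU := hasDerivAt_time_left hk hk0 hJo hq ht (hMt t ht) hu x
  have dV := hasDerivAt_time_right hk hk0 hJo hq ht (hMt t ht) hv x
  obtain ⟨d12, d21, dγ⟩ := hasDerivAt_riccati_rational (U := fun τ => u τ x)
    (V := fun τ => v τ x) hn dU dV
  obtain ⟨dγx, dj⟩ := hasDerivAt_gam_flux hk (hu t ht) (hv t ht) hg x
  have df := (q t).hasDerivAt x
  have dfr : HasDerivAt (negConj (q t)) (deriv (negConj (q t)) x) x :=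
    (hasDerivAt_negConj df).differentiableAt.hasDerivAt
  have dρ : HasDerivAt (fun τ => density κ (q τ) x) (-κ / 2 * (evolution (q t) x * u t x +
      q t x * (laxC κ (q t) x + 2 * laxA κ (q t) x * u t x - laxB κ (q t) x * u t x ^ 2)
      - (negConj (evolution (q t)) x * v t x
      + negConj (q t) x *
        (laxB κ (q t) x - 2 * laxA κ (q t) x * v t x - laxC κ (q t) x * v t x ^ 2)))) t :=
    (((dq.mul dU).sub (dr.mul dV)).const_mul (-κ / 2)).congr_of_eventuallyEq
      (Filter.eventually_of_mem hJt fun τ hτ => density_eq (hval τ hτ).2 (hne τ hτ) x)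
  refine ⟨?_, ?_, ?_, ?_, dγx.differentiableAt, ?_, ?_, dρ.differentiableAt, dj.differentiableAt,
    ?_⟩
  · convert! dq using 1
    rw [iteratedDeriv_succ, iteratedDeriv_one, evolution_eq]
    congr 1
    refine ((df.pow 2).mul dfr).deriv.trans ?_
    simp only [Pi.pow_apply]
    push_cast
    ring
  · convert! dr using 1
    change _ = negConj (evolution (q t)) x
    rw [iteratedDeriv_succ, iteratedDeriv_one, negConj_evolution_eq]
    congr 1
    refine (df.mul (dfr.pow 2)).deriv.trans ?_
    simp only [Pi.pow_apply]
    push_cast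
    ring
  · rw [e1, e2, sub_add_cancel]
    exact d12.congr_of_eventuallyEq
      (Filter.eventually_of_mem hJt fun τ hτ => ((hval τ hτ).2 x).2.1)
  · rw [e1, e3, sub_add_cancel]
    exact d21.congr_of_eventuallyEq
      (Filter.eventually_of_mem hJt fun τ hτ => ((hval τ hτ).2 x).2.2)
  · refine (dγ.congr_of_eventuallyEq
      (Filter.eventually_of_mem hJt fun τ hτ => ((hval τ hτ).2 x).1)).congr_deriv ?_
    -- In `2 (B g₂₁ - C g₁₂)` the terms without `q'` and `r'` combine to `(2κ² + qr) γ'`, since `γ'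
    -- = 2κ (q g₂₁ - r g₁₂)`.
    rw [dγx.deriv, ← e2, ← e3, laxB, laxC]
    ring
  · have h2 : 2 + gam κ (q t) x = 2 / (1 - u t x * v t x) := by
      rw [e1]
      field_simp
      ring
    rw [h2]
    exact div_ne_zero two_ne_zero hn
  · rw [dρ.deriv, dj.deriv]
    ring
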